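/- Let $\mathfrak g$ be the affine Kac--Moody Lie algebra of type $A_2^{(2)}$ over $\mathbb C$, with Cartan subalgebra $\mathfrak h=\mathbb Cc\oplus\mathbb C\alpha^\vee\oplus\mathbb Cd$ and $\mathfrak h^*=\mathbb C\omega_0\oplus\mathbb C\alpha\oplus\mathbb C\delta$, where $\omega_0(c)=1$, $\alpha(\alpha^\vee)=2$, $\delta(d)=1$ and all other values are $0$. The simple roots are $\alpha_0=\delta-2\alpha$, $\alpha_1=\alpha$, the simple coroots are $\alpha_0^\vee=c-\tfrac12\alpha^\vee$, $\alpha_1^\vee=\alpha^\vee$, and the root lattice is $Q=\mathbb Z\alpha+\mathbb Z\delta$. Let $\omega_1=\tfrac12\omega_0+\tfrac12\alpha$ and $\rho=\omega_0+\omega_1$, let $W$ be the Weyl group acting on $\mathfrak h^*$, and let $\varepsilon(w)=(-1)^{\ell(w)}$ for $w\in W$. For dominant integral $\Lambda$ let $L(\Lambda)$ be the irreducible module with highest weight $\Lambda$, $P(\Lambda)$ its set of weights, and $P^o(\Lambda)=\{\lambda\in P(\Lambda):\lambda+n\delta\notin P(\Lambda)\text{ for all integers }n>0\}$. Let $\Lambda=m_0\omega_0+m_1\omega_1$,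 $\Lambda'=m_0'\omega_0+m_1'\omega_1$, $\Lambda''=m_0''\omega_0+m_1''\omega_1$ with all coefficients nonnegative integers. Let $T_\Lambda^{\Lambda',\Lambda''}$ be the set of those $\lambda\in P^o(\Lambda')$ for which there are $v_{\Lambda,\Lambda'',\lambda}\in W$ and $S_{\Lambda,\Lambda'',\lambda}\in\mathbb Z$ (necessarily unique) with $$\lambda+\Lambda''+\rho=v_{\Lambda,\Lambda'',\lambda}(\Lambda+\rho)+S_{\Lambda,\Lambda'',\lambda}\,\delta .$$ Assume that $\Lambda'(c)>0$, $\Lambda''(c)>0$ and $\Lambda-\Lambda'-\Lambda''\in Q$. Then: 1. The set $\{S_{\Lambda,\Lambda'',\lambda}:\lambda\in T_\Lambda^{\Lambda',\Lambda''},\ \varepsilon(v_{\Lambda,\Lambda'',\lambda})=1\}$ has a maximum, and it is attained at some $\lambda$ in this range with $$\lambda\equiv\Lambda'+\tfrac12(m_1-m_1'-m_1'')\alpha \pmod{\mathbb C\delta}.$$ 2. The set $\{S_{\Lambda,\Lambda'',\lambda}:\lambda\in T_\Lambda^{\Lambda',\Lambda''},\ \varepsilon(v_{\Lambda,\Lambda'',\lambda})=-1\}$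 has a maximum, and it is attained at some $\lambda$ in this range with $$\lambda\equiv\Lambda'-\bigl(\tfrac12(m_1'+m_1''+m_1)+1\bigr)\alpha \pmod{\mathbb C\delta}$$ or $$\lambda\equiv\Lambda'-\bigl(\tfrac12(m_1'+m_1''+m_1)-2(\Lambda'(c)+\Lambda''(c)+1)\bigr)\alpha \pmod{\mathbb C\delta}.$$ -/

import Mathlib

open scoped ComplexOrder

noncomputable section

namespace A22

/-! ### The realization of the generalized Cartan matrix -/

/-- The Cartan subalgebra `𝔥 = ℂc ⊕ ℂα^∨ ⊕ ℂd`, in coordinates with respect to `c, α^∨, d`. -/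
abbrev Cartan : Type := Fin 3 → ℂ

/-- The canonical central element `c`. -/
def c : Cartan := ![1, 0, 0]

/-- The coroot `α^∨`. -/
def αv : Cartan := ![0, 1, 0]

/-- The scaling element `d`. -/
def d : Cartan := ![0, 0, 1]

/-- The dual space `𝔥*`. -/
abbrev Weight : Type := Module.Dual ℂ Cartan

/-- `ω₀(c) = 1`, `ω₀(α^∨) = ω₀(d) = 0`. -/
def ω₀ : Weight := LinearMap.proj 0

/-- `α(α^∨) = 2`, `α(c) = α(d) = 0`. -/
def α : Weight := (2 : ℂ) • LinearMap.proj 1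

/-- `δ(d) = 1`, `δ(c) = δ(α^∨) = 0`. -/
def δ : Weight := LinearMap.proj 2

/-- The second fundamental weight `ω₁ = ½ω₀ + ½α`. -/
def ω₁ : Weight := (1 / 2 : ℂ) • ω₀ + (1 / 2 : ℂ) • α

/-- `ρ = ω₀ + ω₁`, which takes the value `1` on both simple coroots. -/
def ρ : Weight := ω₀ + ω₁

/-- The simple roots `α₀ = δ - 2α` and `α₁ = α`. -/
def simpleRoot : Fin 2 → Weight := ![δ - (2 : ℂ) • α, α]

/-- The simple coroots `α₀^∨ = c - ½α^∨` and `α₁^∨ = α^∨`. -/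
def simpleCoroot : Fin 2 → Cartan := ![c - (1 / 2 : ℂ) • αv, αv]

/-- The generalized Cartan matrix of type `A₂⁽²⁾`. -/
def gcm : Matrix (Fin 2) (Fin 2) ℤ := !![2, -1; -4, 2]

theorem simpleRoot_simpleCoroot (i j : Fin 2) :
    simpleRoot j (simpleCoroot i) = (gcm i j : ℂ) := by
  fin_cases i <;> fin_cases j <;>
    (simp [simpleRoot, simpleCoroot, gcm, α, δ, c, αv]; try norm_num)

/-- The root lattice `Q = ℤα + ℤδ`. -/
def Q : AddSubgroup Weight := AddSubgroup.closure {α, δ}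

/-- The dominant integral weight `m₀ω₀ + m₁ω₁`. -/
def wt (m₀ m₁ : ℕ) : Weight := (m₀ : ℂ) • ω₀ + (m₁ : ℂ) • ω₁

/-! ### The Weyl group -/

/-- The simple reflection `s_i(μ) = μ - μ(α_i^∨) α_i` of `𝔥*`. -/
def s (i : Fin 2) : Weight ≃ₗ[ℂ] Weight :=
  Module.reflection (x := simpleRoot i) (f := Module.Dual.eval ℂ Cartan (simpleCoroot i)) (by
    rw [Module.Dual.eval_apply, simpleRoot_simpleCoroot]
    fin_cases i <;> simp [gcm])

/-- The Weyl group, acting on `𝔥*`. -/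
def W : Subgroup (Weight ≃ₗ[ℂ] Weight) := Subgroup.closure (Set.range s)

/-- The length of a Weyl group element: the least length of a word in the simple reflections
that represents it. -/
def length (w : Weight ≃ₗ[ℂ] Weight) : ℕ :=
  sInf {n | ∃ l : List (Fin 2), l.length = n ∧ (l.map s).prod = w}

/-- The sign `ε(w) = (-1)^{ℓ(w)}`. -/
def ε (w : Weight ≃ₗ[ℂ] Weight) : ℤ := (-1) ^ length w

/-! ### The Kac-Moody algebra, by generators and relations -/

/-- Generators: the elements of `𝔥`, and `e_i`, `f_i`. -/
inductive Gen : Type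
  | h : Cartan → Gen
  | e : Fin 2 → Gen
  | f : Fin 2 → Gen

/-- The free Lie algebra on the generators. -/
abbrev Free : Type := FreeLieAlgebra ℂ Gen

def freeH (x : Cartan) : Free := FreeLieAlgebra.of ℂ (Gen.h x)
def freeE (i : Fin 2) : Free := FreeLieAlgebra.of ℂ (Gen.e i)
def freeF (i : Fin 2) : Free := FreeLieAlgebra.of ℂ (Gen.f i)

/-- The defining relators: linearity of `𝔥`, the Chevalley relations and the Serre relations. -/
inductive IsRelator : Free → Prop
  | h_add (x y : Cartan) : IsRelator (freeH (x + y) - (freeH x + freeH y))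
  | h_smul (a : ℂ) (x : Cartan) : IsRelator (freeH (a • x) - a • freeH x)
  | h_h (x y : Cartan) : IsRelator ⁅freeH x, freeH y⁆
  | h_e (x : Cartan) (i : Fin 2) : IsRelator (⁅freeH x, freeE i⁆ - simpleRoot i x • freeE i)
  | h_f (x : Cartan) (i : Fin 2) : IsRelator (⁅freeH x, freeF i⁆ + simpleRoot i x • freeF i)
  | e_f_self (i : Fin 2) : IsRelator (⁅freeE i, freeF i⁆ - freeH (simpleCoroot i))
  | e_f_ne (i j : Fin 2) (hij : i ≠ j) : IsRelator ⁅freeE i, freeF j⁆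
  | serre_e (i j : Fin 2) (hij : i ≠ j) :
      IsRelator (((LieAlgebra.ad ℂ Free (freeE i)) ^ (1 - gcm i j).toNat) (freeE j))
  | serre_f (i j : Fin 2) (hij : i ≠ j) :
      IsRelator (((LieAlgebra.ad ℂ Free (freeF i)) ^ (1 - gcm i j).toNat) (freeF j))

/-- The ideal generated by the relators. -/
def relIdeal : LieIdeal ℂ Free := LieSubmodule.lieSpan ℂ Free {x | IsRelator x}

/-- The Kac-Moody Lie algebra of type `A₂⁽²⁾`. -/
abbrev KM : Type := Free ⧸ relIdeal

/-- Its universal enveloping algebra. -/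
abbrev U : Type := UniversalEnvelopingAlgebra ℂ KM

/-- The image of a generator in the universal enveloping algebra. -/
def gen (x : Free) : U := UniversalEnvelopingAlgebra.ι ℂ (LieSubmodule.Quotient.mk x : KM)

/-! ### Irreducible highest weight modules and their weights -/

/-- The left ideal of `U` generated by `e₀`, `e₁` and all `h - Λ(h)`, `h ∈ 𝔥`. -/
def vermaIdeal (Λ : Weight) : Submodule U U :=
  Submodule.span U
    (Set.range (fun i : Fin 2 => gen (freeE i)) ∪
      Set.range (fun h : Cartan => gen (freeH h) - algebraMap ℂ U (Λ h)))

/-- The Verma module with highest weight `Λ`. -/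
abbrev Verma (Λ : Weight) : Type := U ⧸ vermaIdeal Λ

/-- The largest proper submodule of the Verma module, i.e. the sum of all proper submodules. -/
def maxProper (Λ : Weight) : Submodule U (Verma Λ) := sSup {N | N ≠ ⊤}

/-- The irreducible module `L(Λ)` with highest weight `Λ`. -/
abbrev L (Λ : Weight) : Type := Verma Λ ⧸ maxProper Λ

/-- The set `P(Λ)` of weights of `L(Λ)`. -/
def P (Λ : Weight) : Set Weight :=
  {μ | ∃ x : L Λ, x ≠ 0 ∧ ∀ h : Cartan, gen (freeH h) • x = algebraMap ℂ U (μ h) • x}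

/-- The set `P^o(Λ)` of `δ`-maximal weights of `L(Λ)`. -/
def Po (Λ : Weight) : Set Weight :=
  {μ | μ ∈ P Λ ∧ ∀ n : ℤ, 0 < n → μ + n • δ ∉ P Λ}

/-! ### The set `T` and the numbers `S` -/

/-- `v ∈ W` and `S ∈ ℤ` satisfy `μ + Λ'' + ρ = v(Λ + ρ) + Sδ`; when `Λ` is dominant
they are determined by `Λ`, `Λ''` and `μ`. -/
def IsVS (Λ Λ'' μ : Weight) (v : Weight ≃ₗ[ℂ] Weight) (S : ℤ) : Prop :=
  v ∈ W ∧ μ + Λ'' + ρ = v (Λ + ρ) + S • δ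

/-- The set `T_Λ^{Λ',Λ''}`. -/
def T (Λ Λ' Λ'' : Weight) : Set Weight :=
  {μ | μ ∈ Po Λ' ∧ ∃ v S, IsVS Λ Λ'' μ v S}

/-- The set of all `S_{Λ,Λ'',μ}` with `μ ∈ T_Λ^{Λ',Λ''}` and `ε(v_{Λ,Λ'',μ}) = e`. -/
def SSet (Λ Λ' Λ'' : Weight) (e : ℤ) : Set ℤ :=
  {S | ∃ μ ∈ T Λ Λ' Λ'', ∃ v, IsVS Λ Λ'' μ v S ∧ ε v = e}

/-- The set `SSet Λ Λ' Λ'' e` has a maximum, and it is attained at some `μ ∈ T_Λ^{Λ',Λ''}`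
(with `ε(v_{Λ,Λ'',μ}) = e`) that is congruent to `ν` modulo `ℂδ`. -/
def MaxOccursAt (Λ Λ' Λ'' : Weight) (e : ℤ) (ν : Weight) : Prop :=
  ∃ S, IsGreatest (SSet Λ Λ' Λ'' e) S ∧
    ∃ μ ∈ T Λ Λ' Λ'', (∃ v, IsVS Λ Λ'' μ v S ∧ ε v = e) ∧ ∃ z : ℂ, μ = ν + z • δ

end A22

end

noncomputable section

namespace A22

-- Write a weight as kω₀ + xα + nδ (`pt k x n`). On level k a Weyl group element sends x to σx + 2kt
-- and n to n − σxt − kt², where σ is its sign and t an integer. Applying v⁻¹ to λ + Λ'' + ρ = v(Λ +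
-- ρ) + Sδ replaces λ by the weight v⁻¹λ = Λ' + jα + nδ of L(Λ'). Put K = 2m₀'' + m₁'' + 3 and p =
-- (m₁ − m₁' − m₁'')/2, and let t belong to v⁻¹. Then j = p − Kt if σ = 1, j = p + m₁'' + 1 − Kt if
-- σ = −1, and S is n minus a quadratic in t (`exists_coordinates_of_isVS`).
--
-- It remains to compare the largest n over an arithmetic progression of j. With a weight μ, all μ −
-- rα_i with r between 0 and μ(α_i^∨) are weights. Such strings keep n for i = 1 and keep 2n + j for
-- i = 0, so moving a weight towards the middle of the progression costs at most a linear amount in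
-- t, which the quadratic outweighs. For σ = 1 the best choice is t = 0 (`exists_even_bound`); for σ
-- = −1 it is t = 0 or t = 1 (`exists_odd_bound`). The elements 1, s₁ and s₀ realize these values.
--
-- The string property is sl₂-theory on L(Λ') (`sub_mem_P`, `add_mem_P`). It needs local nilpotency
-- of f_i, which follows from the Serre relations and f_i^(m+1) killing the highest weight vector
-- (`uF_pow_smul_highestVec`). That this vector is nonzero is seen in an explicit model: words in
-- the f_i modulo the Serre elements (`exists_highest_coeff`).

attribute [local instance 100] LieRing.ofAssociativeRing

/-! ### Chevalley relations and the universal properties of `KM` and `U`. -/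

/-- The defining relations of `KM` without the Serre relations, for elements of a Lie algebra. -/
structure IsPreChevalley {A : Type*} [LieRing A] [LieAlgebra ℂ A]
    (h : Cartan →ₗ[ℂ] A) (e f : Fin 2 → A) : Prop where
  h_h (x y : Cartan) : ⁅h x, h y⁆ = 0
  h_e (x : Cartan) (i : Fin 2) : ⁅h x, e i⁆ = simpleRoot i x • e i
  h_f (x : Cartan) (i : Fin 2) : ⁅h x, f i⁆ = -(simpleRoot i x • f i)
  e_f_self (i : Fin 2) : ⁅e i, f i⁆ = h (simpleCoroot i)
  e_f_ne (i j : Fin 2) (hij : i ≠ j) : ⁅e i, f j⁆ = 0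

/-- The defining relations of `KM`, for elements of a Lie algebra. -/
structure IsChevalley {A : Type*} [LieRing A] [LieAlgebra ℂ A]
    (h : Cartan →ₗ[ℂ] A) (e f : Fin 2 → A) : Prop extends IsPreChevalley h e f where
  serre_e (i j : Fin 2) (hij : i ≠ j) :
    ((LieAlgebra.ad ℂ A (e i)) ^ (1 - gcm i j).toNat) (e j) = 0
  serre_f (i j : Fin 2) (hij : i ≠ j) :
    ((LieAlgebra.ad ℂ A (f i)) ^ (1 - gcm i j).toNat) (f j) = 0

theorem map_ad_pow {A B : Type*} [LieRing A] [LieAlgebra ℂ A] [LieRing B] [LieAlgebra ℂ B]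
    (φ : A →ₗ⁅ℂ⁆ B) (a b : A) (n : ℕ) :
    φ (((LieAlgebra.ad ℂ A a) ^ n) b) = ((LieAlgebra.ad ℂ B (φ a)) ^ n) (φ b) := by
  induction n with
  | zero => rfl
  | succ n ih => simp only [pow_succ', Module.End.mul_apply, LieAlgebra.ad_apply, LieHom.map_lie, ih]

/-- The Cartan subalgebra, mapped to the Kac-Moody algebra. -/
def kmH : Cartan →ₗ[ℂ] KM where
  toFun x := LieSubmodule.Quotient.mk (freeH x)
  map_add' x y := by
    rw [← sub_eq_zero]
    exact (LieSubmodule.Quotient.mk_eq_zero' (N := relIdeal)).2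
      (LieSubmodule.subset_lieSpan (IsRelator.h_add x y))
  map_smul' a x := by
    rw [← sub_eq_zero]
    exact (LieSubmodule.Quotient.mk_eq_zero' (N := relIdeal)).2
      (LieSubmodule.subset_lieSpan (IsRelator.h_smul a x))

def kmE (i : Fin 2) : KM := LieSubmodule.Quotient.mk (freeE i)

def kmF (i : Fin 2) : KM := LieSubmodule.Quotient.mk (freeF i)

/-- The quotient map onto the Kac-Moody algebra. -/
def kmMk : Free →ₗ⁅ℂ⁆ KM where
  toLinearMap := relIdeal.toSubmodule.mkQ
  map_lie' := fun {x y} => LieSubmodule.Quotient.mk_bracket relIdeal x y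

theorem kmMk_eq_zero {r : Free} (hr : IsRelator r) : kmMk r = 0 :=
  (LieSubmodule.Quotient.mk_eq_zero' (N := relIdeal)).2 (LieSubmodule.subset_lieSpan hr)

theorem isChevalley_km : IsChevalley kmH kmE kmF where
  h_h x y := by
    have := kmMk_eq_zero (IsRelator.h_h x y)
    rwa [LieHom.map_lie] at this
  h_e x i := by
    have := kmMk_eq_zero (IsRelator.h_e x i)
    rwa [map_sub, LieHom.map_lie, map_smul, sub_eq_zero] at this
  h_f x i := by
    have := kmMk_eq_zero (IsRelator.h_f x i)
    rwa [map_add, LieHom.map_lie, map_smul, add_eq_zero_iff_eq_neg] at this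
  e_f_self i := by
    have := kmMk_eq_zero (IsRelator.e_f_self i)
    rwa [map_sub, LieHom.map_lie, sub_eq_zero] at this
  e_f_ne i j hij := by
    have := kmMk_eq_zero (IsRelator.e_f_ne i j hij)
    rwa [LieHom.map_lie] at this
  serre_e i j hij := by
    have := kmMk_eq_zero (IsRelator.serre_e i j hij)
    rwa [map_ad_pow] at this
  serre_f i j hij := by
    have := kmMk_eq_zero (IsRelator.serre_f i j hij)
    rwa [map_ad_pow] at this

namespace IsChevalley

section Lift

variable {A : Type*} [LieRing A] [LieAlgebra ℂ A] {h : Cartan →ₗ[ℂ] A} {e f : Fin 2 → A}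

theorem map {B : Type*} [LieRing B] [LieAlgebra ℂ B] (hc : IsChevalley h e f)
    (φ : A →ₗ⁅ℂ⁆ B) : IsChevalley (φ.toLinearMap ∘ₗ h) (φ ∘ e) (φ ∘ f) where
  h_h x y := by simp [← LieHom.map_lie, hc.h_h]
  h_e x i := by simp [← LieHom.map_lie, hc.h_e]
  h_f x i := by simp [← LieHom.map_lie, hc.h_f]
  e_f_self i := by simp [← LieHom.map_lie, hc.e_f_self]
  e_f_ne i j hij := by simp [← LieHom.map_lie, hc.e_f_ne i j hij]
  serre_e i j hij := by simp [← map_ad_pow, hc.serre_e i j hij]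
  serre_f i j hij := by simp [← map_ad_pow, hc.serre_f i j hij]

/-- The homomorphism from the free Lie algebra determined by images of the generators. -/
def freeLift (h : Cartan →ₗ[ℂ] A) (e f : Fin 2 → A) : Free →ₗ⁅ℂ⁆ A :=
  FreeLieAlgebra.lift ℂ fun g => match g with
    | Gen.h x => h x
    | Gen.e i => e i
    | Gen.f i => f i

@[simp] theorem freeLift_h (x : Cartan) : freeLift h e f (freeH x) = h x := by
  simp [freeLift, freeH]

@[simp] theorem freeLift_e (i : Fin 2) : freeLift h e f (freeE i) = e i := by
  simp [freeLift, freeE]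

@[simp] theorem freeLift_f (i : Fin 2) : freeLift h e f (freeF i) = f i := by
  simp [freeLift, freeF]

theorem relIdeal_le_ker (hc : IsChevalley h e f) : relIdeal ≤ (freeLift h e f).ker := by
  refine LieSubmodule.lieSpan_le.2 fun r hr => ?_
  change freeLift h e f r = 0
  cases hr with
  | h_add x y => simp
  | h_smul a x => simp
  | h_h x y => simp [hc.h_h]
  | h_e x i => simp [hc.h_e]
  | h_f x i => simp [hc.h_f]
  | e_f_self i => simp [hc.e_f_self]
  | e_f_ne i j hij => simp [hc.e_f_ne i j hij]
  | serre_e i j hij => simp [map_ad_pow, hc.serre_e i j hij]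
  | serre_f i j hij => simp [map_ad_pow, hc.serre_f i j hij]

/-- The homomorphism from the Kac-Moody algebra determined by elements satisfying its
defining relations. -/
def lift (hc : IsChevalley h e f) : KM →ₗ⁅ℂ⁆ A where
  toLinearMap := relIdeal.toSubmodule.liftQ (freeLift h e f).toLinearMap hc.relIdeal_le_ker
  map_lie' := fun {x y} => by
    induction x using Submodule.Quotient.induction_on with | _ x
    induction y using Submodule.Quotient.induction_on with | _ y
    exact (freeLift h e f).map_lie x y

theorem lift_mk (hc : IsChevalley h e f) (x : Free) :
    hc.lift (LieSubmodule.Quotient.mk x) = freeLift h e f x := rfl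

end Lift

variable {A : Type*} [Ring A] [Algebra ℂ A] {h : Cartan →ₗ[ℂ] A} {e f : Fin 2 → A}

/-- The algebra homomorphism from the enveloping algebra determined by elements satisfying the
defining relations. -/
def algLift (hc : IsChevalley h e f) : U →ₐ[ℂ] A := UniversalEnvelopingAlgebra.lift ℂ hc.lift

theorem algLift_gen (hc : IsChevalley h e f) (x : Free) :
    hc.algLift (gen x) = freeLift h e f x := by
  rw [gen, algLift, UniversalEnvelopingAlgebra.lift_ι_apply, lift_mk]

end IsChevalley

def uH : Cartan →ₗ[ℂ] U := (UniversalEnvelopingAlgebra.ι ℂ).toLinearMap ∘ₗ kmH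
def uE : Fin 2 → U := UniversalEnvelopingAlgebra.ι ℂ ∘ kmE
def uF : Fin 2 → U := UniversalEnvelopingAlgebra.ι ℂ ∘ kmF

theorem gen_freeH (x : Cartan) : gen (freeH x) = uH x := rfl
theorem gen_freeE (i : Fin 2) : gen (freeE i) = uE i := rfl
theorem gen_freeF (i : Fin 2) : gen (freeF i) = uF i := rfl

theorem isChevalley_u : IsChevalley uH uE uF := isChevalley_km.map (UniversalEnvelopingAlgebra.ι ℂ)

theorem u_hom_ext {A : Type*} [Ring A] [Algebra ℂ A] {φ ψ : U →ₐ[ℂ] A}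
    (hh : ∀ x, φ (uH x) = ψ (uH x)) (he : ∀ i, φ (uE i) = ψ (uE i))
    (hf : ∀ i, φ (uF i) = ψ (uF i)) : φ = ψ := by
  refine UniversalEnvelopingAlgebra.hom_ext ℂ ?_
  have key : ((φ : U →ₗ⁅ℂ⁆ A).comp (UniversalEnvelopingAlgebra.ι ℂ)).comp kmMk =
      ((ψ : U →ₗ⁅ℂ⁆ A).comp (UniversalEnvelopingAlgebra.ι ℂ)).comp kmMk := by
    refine FreeLieAlgebra.hom_ext fun g => ?_
    cases g with
    | h x => exact hh x
    | e i => exact he i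
    | f i => exact hf i
  refine LieHom.ext fun x => ?_
  induction x using Submodule.Quotient.induction_on with | _ x
  exact LieHom.congr_fun key x

/-- A subalgebra of the enveloping algebra that contains the generators is everything. -/
theorem subalgebra_eq_top (B : Subalgebra ℂ U) (hh : ∀ x, uH x ∈ B) (he : ∀ i, uE i ∈ B)
    (hf : ∀ i, uF i ∈ B) : B = ⊤ := by
  have inj : ∀ {x : B}, (x : U) = 0 → x = 0 := fun h => Subtype.ext h
  have pw : ∀ (a b : B) (n : ℕ), ((((LieAlgebra.ad ℂ B a) ^ n) b : B) : U) =
      ((LieAlgebra.ad ℂ U (a : U)) ^ n) (b : U) := fun a b n =>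
    map_ad_pow (B.val : B →ₗ⁅ℂ⁆ U) a b n
  have hc : IsChevalley (A := B) (LinearMap.codRestrict B.toSubmodule uH hh)
      (fun i => ⟨uE i, he i⟩) (fun i => ⟨uF i, hf i⟩) :=
    { h_h := fun x y => Subtype.ext (isChevalley_u.h_h x y)
      h_e := fun x i => Subtype.ext (isChevalley_u.h_e x i)
      h_f := fun x i => Subtype.ext (isChevalley_u.h_f x i)
      e_f_self := fun i => Subtype.ext (isChevalley_u.e_f_self i)
      e_f_ne := fun i j hij => Subtype.ext (isChevalley_u.e_f_ne i j hij)
      serre_e := fun i j hij => inj ((pw _ _ _).trans (isChevalley_u.serre_e i j hij))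
      serre_f := fun i j hij => inj ((pw _ _ _).trans (isChevalley_u.serre_f i j hij)) }
  -- The relations hold inside `B`, so there is a map from `U` to `B`; followed by the inclusion it
  -- fixes the generators and is therefore the identity.
  have key : B.val.comp hc.algLift = AlgHom.id ℂ U := by
    refine u_hom_ext (fun x => ?_) (fun i => ?_) (fun i => ?_)
    · rw [← gen_freeH, AlgHom.comp_apply, hc.algLift_gen, IsChevalley.freeLift_h]; rfl
    · rw [← gen_freeE, AlgHom.comp_apply, hc.algLift_gen, IsChevalley.freeLift_e]; rfl
    · rw [← gen_freeF, AlgHom.comp_apply, hc.algLift_gen, IsChevalley.freeLift_f]; rfl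
  refine eq_top_iff.2 fun u _ => ?_
  have := congrArg (fun φ : U →ₐ[ℂ] U => φ u) key
  simp only [AlgHom.comp_apply, AlgHom.id_apply] at this
  rw [← this]
  exact (hc.algLift u).2

/-! ### sl₂-computations and the Serre elements. -/

section Sl2

variable {A M : Type*} [LieRing A] [LieAlgebra ℂ A] [AddCommGroup M] [Module ℂ M]
  [LieRingModule A M] [LieModule ℂ A M] {h e f : A}

theorem lie_h_pow_f (hf : ⁅h, f⁆ = -((2 : ℂ) • f)) {m : M} {μ : ℂ} (hm : ⁅h, m⁆ = μ • m) (n : ℕ) :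
    ⁅h, ((LieModule.toEnd ℂ A M f) ^ n) m⁆ =
      (μ - 2 * n) • ((LieModule.toEnd ℂ A M f) ^ n) m := by
  induction n with
  | zero => simpa using hm
  | succ n ih =>
    rw [pow_succ', Module.End.mul_apply, LieModule.toEnd_apply_apply, leibniz_lie h, hf, ih,
      neg_lie, smul_lie, lie_smul, ← neg_smul, ← add_smul]
    congr 1
    push_cast; ring

/-- The factor (n + 1)(μ − n) vanishes for n = μ. With `f i` acting by the adjoint action on `f j`,
this is why the Serre element commutes with `e i`. -/
theorem lie_e_pow_succ_f (hf : ⁅h, f⁆ = -((2 : ℂ) • f)) (hef : ⁅e, f⁆ = h) {m : M} {μ : ℂ}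
    (hm : ⁅h, m⁆ = μ • m) (he : ⁅e, m⁆ = 0) (n : ℕ) :
    ⁅e, ((LieModule.toEnd ℂ A M f) ^ (n + 1)) m⁆ =
      ((n + 1) * (μ - n)) • ((LieModule.toEnd ℂ A M f) ^ n) m := by
  induction n with
  | zero => simp [leibniz_lie e, hef, he, hm]
  | succ n ih =>
    rw [pow_succ', Module.End.mul_apply, LieModule.toEnd_apply_apply, leibniz_lie e, hef,
      lie_h_pow_f hf hm, ih, lie_smul, ← LieModule.toEnd_apply_apply ℂ A M f,
      ← Module.End.mul_apply, ← pow_succ', ← add_smul]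
    congr 1
    push_cast; ring

end Sl2

theorem simpleRoot_coroot_self (i : Fin 2) : simpleRoot i (simpleCoroot i) = 2 := by
  rw [simpleRoot_simpleCoroot]; fin_cases i <;> simp [gcm]

theorem toNat_one_sub_gcm {i j : Fin 2} (hij : i ≠ j) :
    ∃ n : ℕ, (1 - gcm i j).toNat = n + 1 ∧ 1 ≤ n ∧ (gcm i j : ℂ) = -n := by
  fin_cases i <;> fin_cases j <;> simp [gcm] at hij ⊢

namespace IsPreChevalley

variable {A : Type*} [LieRing A] [LieAlgebra ℂ A] {h : Cartan →ₗ[ℂ] A} {e f : Fin 2 → A}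

/-- The Chevalley involution, used to exchange the roles of `e` and `f`. -/
theorem symm (hc : IsPreChevalley h e f) : IsPreChevalley (-h) f e where
  h_h x y := by simp [hc.h_h]
  h_e x i := by simp [hc.h_f]
  h_f x i := by simp [hc.h_e]
  e_f_self i := by rw [← lie_skew, hc.e_f_self]; rfl
  e_f_ne i j hij := by rw [← lie_skew, hc.e_f_ne j i hij.symm, neg_zero]

/-- The Serre elements in the `f i` commute with the `e k`. -/
theorem lie_e_serre_f (hc : IsPreChevalley h e f) {i j : Fin 2} (hij : i ≠ j) (k : Fin 2) :
    ⁅e k, ((LieAlgebra.ad ℂ A (f i)) ^ (1 - gcm i j).toNat) (f j)⁆ = 0 := by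
  obtain ⟨n, hn, hn1, hg⟩ := toNat_one_sub_gcm hij
  rw [hn]
  by_cases hk : k = i
  · subst hk
    have hf : ⁅h (simpleCoroot k), f k⁆ = -((2 : ℂ) • f k) := by
      rw [hc.h_f, simpleRoot_coroot_self]
    have hm : ⁅h (simpleCoroot k), f j⁆ = (n : ℂ) • f j := by
      rw [hc.h_f, simpleRoot_simpleCoroot, hg, neg_smul, neg_neg]
    have := lie_e_pow_succ_f (M := A) hf (hc.e_f_self k) hm (hc.e_f_ne k j hij) n
    rw [sub_self, mul_zero, zero_smul] at this
    exact this
  · obtain rfl : k = j := by omega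
    have h1 : ∀ m : ℕ, ⁅e k, ((LieAlgebra.ad ℂ A (f i)) ^ m) (f k)⁆ =
        ((LieAlgebra.ad ℂ A (f i)) ^ m) (h (simpleCoroot k)) := by
      intro m
      induction m with
      | zero => exact hc.e_f_self k
      | succ m ih =>
        rw [pow_succ', Module.End.mul_apply, Module.End.mul_apply, LieAlgebra.ad_apply,
          leibniz_lie, hc.e_f_ne k i hk, ih, zero_lie, zero_add, LieAlgebra.ad_apply]
    -- As n ≥ 1, at least two brackets with `f i` hit the Cartan element: the first gives a multiple
    -- of `f i`, the second kills it.
    obtain ⟨m, rfl⟩ : ∃ m, n = m + 1 := ⟨n - 1, by omega⟩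
    rw [h1, pow_succ, pow_succ, Module.End.mul_apply, Module.End.mul_apply, LieAlgebra.ad_apply,
      LieAlgebra.ad_apply, ← lie_skew (f i) (h (simpleCoroot k)), hc.h_f]
    simp

/-- The Serre elements in the `e i` commute with the `f k`. -/
theorem lie_f_serre_e (hc : IsPreChevalley h e f) {i j : Fin 2} (hij : i ≠ j) (k : Fin 2) :
    ⁅f k, ((LieAlgebra.ad ℂ A (e i)) ^ (1 - gcm i j).toNat) (e j)⁆ = 0 :=
  hc.symm.lie_e_serre_f hij k

theorem lie_h_serre_f (hc : IsPreChevalley h e f) (i j : Fin 2) (x : Cartan) (n : ℕ) :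
    ⁅h x, ((LieAlgebra.ad ℂ A (f i)) ^ n) (f j)⁆ =
      (-((n : ℂ) * simpleRoot i x + simpleRoot j x)) •
        ((LieAlgebra.ad ℂ A (f i)) ^ n) (f j) := by
  induction n with
  | zero => simp [hc.h_f]
  | succ n ih =>
    rw [pow_succ', Module.End.mul_apply, LieAlgebra.ad_apply, leibniz_lie, ih, hc.h_f, neg_lie,
      smul_lie, lie_smul, ← neg_smul, ← add_smul]
    congr 1
    push_cast; ring

end IsPreChevalley

/-! ### A model of the Verma module without Serre relations, on words in the `f i` -/

/-- Linear combinations of words in two letters. -/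
abbrev Words : Type := List (Fin 2) →₀ ℂ

/-- The sum of the simple roots in a word. -/
def rootSum (l : List (Fin 2)) : Weight := (l.map simpleRoot).sum

@[simp] theorem rootSum_nil : rootSum [] = 0 := rfl

@[simp] theorem rootSum_cons (i : Fin 2) (l : List (Fin 2)) :
    rootSum (i :: l) = simpleRoot i + rootSum l := by simp [rootSum]

def wordF (i : Fin 2) : Module.End ℂ Words := Finsupp.lmapDomain ℂ ℂ (List.cons i)

@[simp] theorem wordF_single (i : Fin 2) (l : List (Fin 2)) (a : ℂ) :
    wordF i (Finsupp.single l a) = Finsupp.single (i :: l) a := by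
  simp [wordF]

def wordH (Λ : Weight) : Cartan →ₗ[ℂ] Module.End ℂ Words where
  toFun x := Finsupp.linearCombination ℂ fun l => ((Λ - rootSum l) x) • Finsupp.single l 1
  map_add' x y := by
    ext l : 2
    simp [-Finsupp.smul_single, add_smul, sub_smul, add_sub_add_comm]
  map_smul' a x := by
    ext l : 2
    simp [-Finsupp.smul_single, mul_smul, sub_smul, smul_sub]

@[simp] theorem wordH_single (Λ : Weight) (x : Cartan) (l : List (Fin 2)) :
    wordH Λ x (Finsupp.single l 1) = ((Λ - rootSum l) x) • Finsupp.single l 1 := by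
  simp [wordH]

/-- The action of `e k` on words, determined by `⁅e k, f i⁆ = δ_{ki} α_k^∨`. -/
def wordEAux (Λ : Weight) (k : Fin 2) : List (Fin 2) → Words
  | [] => 0
  | i :: l => wordF i (wordEAux Λ k l) +
      if k = i then ((Λ - rootSum l) (simpleCoroot k)) • Finsupp.single l 1 else 0

def wordE (Λ : Weight) (k : Fin 2) : Module.End ℂ Words :=
  Finsupp.linearCombination ℂ (wordEAux Λ k)

@[simp] theorem wordE_single (Λ : Weight) (k : Fin 2) (l : List (Fin 2)) :
    wordE Λ k (Finsupp.single l 1) = wordEAux Λ k l := by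
  simp [wordE]

theorem wordH_wordF (Λ : Weight) (x : Cartan) (i : Fin 2) (y : Words) :
    wordH Λ x (wordF i y) = wordF i (wordH Λ x y) - simpleRoot i x • wordF i y := by
  have : wordH Λ x ∘ₗ wordF i = wordF i ∘ₗ wordH Λ x - simpleRoot i x • wordF i := by
    ext l : 2
    simp only [LinearMap.comp_apply, Finsupp.lsingle_apply, wordF_single, wordH_single, map_smul,
      LinearMap.sub_apply, LinearMap.smul_apply, ← sub_smul, rootSum_cons, LinearMap.add_apply]
    congr 1; ring
  exact LinearMap.congr_fun this y

theorem wordH_wordEAux (Λ : Weight) (x : Cartan) (k : Fin 2) (l : List (Fin 2)) :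
    wordH Λ x (wordEAux Λ k l) = ((Λ - rootSum l + simpleRoot k) x) • wordEAux Λ k l := by
  induction l with
  | nil => simp [wordEAux]
  | cons i l ih =>
    rw [wordEAux, map_add, wordH_wordF, ih, smul_add, map_smul, ← sub_smul]
    congr 1
    · congr 1; simp; ring
    · split_ifs with hk
      · rw [map_smul, wordH_single, smul_comm, hk]
        congr 1; simp; ring
      · simp

theorem isPreChevalley_word (Λ : Weight) : IsPreChevalley (wordH Λ) (wordE Λ) wordF where
  h_h x y := by
    ext l : 2
    simp only [LinearMap.comp_apply, Finsupp.lsingle_apply, LieRing.of_associative_ring_bracket,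
      LinearMap.sub_apply, Module.End.mul_apply, wordH_single, map_smul, LinearMap.zero_apply]
    rw [smul_comm, sub_self]
  h_e x i := by
    ext l : 2
    simp only [LinearMap.comp_apply, Finsupp.lsingle_apply, LieRing.of_associative_ring_bracket,
      LinearMap.sub_apply, Module.End.mul_apply, wordH_single, map_smul, wordE_single,
      wordH_wordEAux, LinearMap.smul_apply, ← sub_smul]
    congr 1; simp
  h_f x i := by
    ext l : 2
    simp only [LinearMap.comp_apply, Finsupp.lsingle_apply, LieRing.of_associative_ring_bracket,
      LinearMap.sub_apply, Module.End.mul_apply, wordH_wordF, LinearMap.neg_apply,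
      LinearMap.smul_apply, sub_sub_cancel_left]
  e_f_self i := by
    ext l : 2
    simp only [LinearMap.comp_apply, Finsupp.lsingle_apply, LieRing.of_associative_ring_bracket,
      LinearMap.sub_apply, Module.End.mul_apply, wordF_single, wordE_single, wordEAux, if_true,
      wordH_single, add_sub_cancel_left]
  e_f_ne i j hij := by
    ext l : 2
    simp only [LinearMap.comp_apply, Finsupp.lsingle_apply, LieRing.of_associative_ring_bracket,
      LinearMap.sub_apply, Module.End.mul_apply, wordF_single, wordE_single, wordEAux, if_neg hij,
      add_zero, sub_self, LinearMap.zero_apply]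

/-- The Serre elements in the `f i`, acting on words. -/
def serreF (i j : Fin 2) : Module.End ℂ Words :=
  ((LieAlgebra.ad ℂ (Module.End ℂ Words) (wordF i)) ^ (1 - gcm i j).toNat) (wordF j)

/-- The Serre element θ in the e's kills the empty word and commutes with every `wordF k`, hence
kills every word. Only the Serre relations in the f's have to be imposed. -/
theorem serre_wordE (Λ : Weight) {i j : Fin 2} (hij : i ≠ j) :
    ((LieAlgebra.ad ℂ (Module.End ℂ Words) (wordE Λ i)) ^ (1 - gcm i j).toNat) (wordE Λ j) = 0 := by
  set θ := ((LieAlgebra.ad ℂ (Module.End ℂ Words) (wordE Λ i)) ^ (1 - gcm i j).toNat) (wordE Λ j)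
    with hθ
  have h0 : ∀ n : ℕ, ((LieAlgebra.ad ℂ (Module.End ℂ Words) (wordE Λ i)) ^ n) (wordE Λ j)
      (Finsupp.single [] 1) = 0 := by
    intro n
    induction n with
    | zero => simp [wordEAux]
    | succ n ih =>
      rw [pow_succ', Module.End.mul_apply, LieAlgebra.ad_apply,
        LieRing.of_associative_ring_bracket, LinearMap.sub_apply, Module.End.mul_apply,
        Module.End.mul_apply, ih, wordE_single, wordEAux, map_zero, map_zero, sub_zero]
  have hc : ∀ k y, θ (wordF k y) = wordF k (θ y) := fun k y => by
    have := LinearMap.congr_fun ((isPreChevalley_word Λ).lie_f_serre_e hij k) y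
    rw [LieRing.of_associative_ring_bracket, LinearMap.sub_apply, LinearMap.zero_apply,
      sub_eq_zero] at this
    exact this.symm
  ext l : 2
  simp only [LinearMap.comp_apply, Finsupp.lsingle_apply, LinearMap.zero_apply]
  induction l with
  | nil => exact h0 _
  | cons k l ih => rw [← wordF_single, hc, ih, map_zero]

/-- The image of the ideal generated by the Serre elements. -/
def serreSpan : Submodule ℂ Words :=
  Submodule.span ℂ {y | ∃ (u : List (Fin 2)) (i j : Fin 2) (x : Words), i ≠ j ∧
    y = (u.map wordF).prod (serreF i j x)}

theorem serreSpan_le_comap {T : Module.End ℂ Words}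
    (hT : ∀ (u : List (Fin 2)) (i j : Fin 2) (x : Words), i ≠ j →
      T ((u.map wordF).prod (serreF i j x)) ∈ serreSpan) :
    serreSpan ≤ serreSpan.comap T := by
  refine Submodule.span_le.2 ?_
  rintro _ ⟨u, i, j, x, hij, rfl⟩
  exact hT u i j x hij

theorem mem_serreSpan (u : List (Fin 2)) {i j : Fin 2} (hij : i ≠ j) (x : Words) :
    (u.map wordF).prod (serreF i j x) ∈ serreSpan :=
  Submodule.subset_span ⟨u, i, j, x, hij, rfl⟩

theorem wordF_mem_serreSpan (k : Fin 2) : serreSpan ≤ serreSpan.comap (wordF k) :=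
  serreSpan_le_comap fun u i j x hij => by
    simpa using mem_serreSpan (k :: u) hij x

theorem wordH_mem_serreSpan (Λ : Weight) (h : Cartan) :
    serreSpan ≤ serreSpan.comap (wordH Λ h) :=
  serreSpan_le_comap fun u i j x hij => by
    induction u with
    | nil =>
      have := LinearMap.congr_fun ((isPreChevalley_word Λ).lie_h_serre_f i j h
        (1 - gcm i j).toNat) x
      rw [LieRing.of_associative_ring_bracket, LinearMap.sub_apply, sub_eq_iff_eq_add] at this
      change wordH Λ h (serreF i j x) ∈ serreSpan
      change wordH Λ h (serreF i j x) = _ at this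
      rw [this]
      exact add_mem (Submodule.smul_mem _ _ (mem_serreSpan [] hij x))
        (mem_serreSpan [] hij (wordH Λ h x))
    | cons k u ih =>
      rw [List.map_cons, List.prod_cons, Module.End.mul_apply, wordH_wordF]
      exact sub_mem (wordF_mem_serreSpan k ih)
        (Submodule.smul_mem _ _ (wordF_mem_serreSpan k (mem_serreSpan u hij x)))

/-- Induction on the prefix `u`: e_k commutes with the Serre elements, and its commutator with a
letter is zero or a Cartan element, which also preserves the span. -/
theorem wordE_mem_serreSpan (Λ : Weight) (k : Fin 2) :
    serreSpan ≤ serreSpan.comap (wordE Λ k) :=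
  serreSpan_le_comap fun u i j x hij => by
    induction u with
    | nil =>
      have := LinearMap.congr_fun ((isPreChevalley_word Λ).lie_e_serre_f hij k) x
      rw [LieRing.of_associative_ring_bracket, LinearMap.sub_apply, LinearMap.zero_apply,
        sub_eq_zero] at this
      change wordE Λ k (serreF i j x) ∈ serreSpan
      change wordE Λ k (serreF i j x) = serreF i j (wordE Λ k x) at this
      rw [this]
      exact mem_serreSpan [] hij (wordE Λ k x)
    | cons l u ih =>
      rw [List.map_cons, List.prod_cons, Module.End.mul_apply]
      by_cases hk : k = l
      · subst hk
        have := LinearMap.congr_fun ((isPreChevalley_word Λ).e_f_self k)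
          ((u.map wordF).prod (serreF i j x))
        rw [LieRing.of_associative_ring_bracket, LinearMap.sub_apply, sub_eq_iff_eq_add] at this
        exact this ▸ add_mem (wordH_mem_serreSpan Λ _ (mem_serreSpan u hij x))
          (wordF_mem_serreSpan k ih)
      · have := LinearMap.congr_fun ((isPreChevalley_word Λ).e_f_ne k l hk)
          ((u.map wordF).prod (serreF i j x))
        rw [LieRing.of_associative_ring_bracket, LinearMap.sub_apply, LinearMap.zero_apply,
          sub_eq_zero] at this
        exact this ▸ wordF_mem_serreSpan l ih

/-- The coefficient of the empty word. -/
def nilCoeff : Words →ₗ[ℂ] ℂ := Finsupp.lapply []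

theorem nilCoeff_wordF (i : Fin 2) (y : Words) : nilCoeff (wordF i y) = 0 :=
  Finsupp.mapDomain_of_notMem_range _ _ (by simp)

/-- Serre elements and their left multiples only produce nonempty words, so the highest weight
vector survives in the quotient. -/
theorem serreSpan_le_ker : serreSpan ≤ LinearMap.ker nilCoeff := by
  refine Submodule.span_le.2 ?_
  rintro _ ⟨u, i, j, x, hij, rfl⟩
  change nilCoeff _ = 0
  cases u with
  | nil =>
    change nilCoeff (((LieAlgebra.ad ℂ (Module.End ℂ Words) (wordF i)) ^ _) (wordF j) x) = 0
    generalize (1 - gcm i j).toNat = n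
    induction n generalizing x with
    | zero => exact nilCoeff_wordF j x
    | succ n ih =>
      rw [pow_succ', Module.End.mul_apply, LieAlgebra.ad_apply,
        LieRing.of_associative_ring_bracket, LinearMap.sub_apply, map_sub, Module.End.mul_apply,
        Module.End.mul_apply, ih, nilCoeff_wordF, sub_zero]
  | cons k u => exact nilCoeff_wordF k _

/-! ### The quotient by the Serre elements -/

abbrev WordQuot : Type := Words ⧸ serreSpan

def quotF (i : Fin 2) : Module.End ℂ WordQuot := serreSpan.mapQ _ _ (wordF_mem_serreSpan i)

def quotE (Λ : Weight) (i : Fin 2) : Module.End ℂ WordQuot :=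
  serreSpan.mapQ _ _ (wordE_mem_serreSpan Λ i)

def quotH (Λ : Weight) : Cartan →ₗ[ℂ] Module.End ℂ WordQuot where
  toFun x := serreSpan.mapQ _ _ (wordH_mem_serreSpan Λ x)
  map_add' x y := by
    ext l : 3
    exact congrArg serreSpan.mkQ (LinearMap.congr_fun ((wordH Λ).map_add x y) _)
  map_smul' a x := by
    ext l : 3
    exact congrArg serreSpan.mkQ (LinearMap.congr_fun ((wordH Λ).map_smul a x) _)

theorem mapQ_ad_pow {S T : Module.End ℂ Words} (hS : serreSpan ≤ serreSpan.comap S)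
    (hT : serreSpan ≤ serreSpan.comap T) (n : ℕ) (x : Words) :
    ((LieAlgebra.ad ℂ (Module.End ℂ WordQuot) (serreSpan.mapQ _ S hS)) ^ n)
      (serreSpan.mapQ _ T hT) (serreSpan.mkQ x) =
    serreSpan.mkQ (((LieAlgebra.ad ℂ (Module.End ℂ Words) S) ^ n) T x) := by
  induction n generalizing x with
  | zero => rfl
  | succ n ih =>
    simp only [pow_succ', Module.End.mul_apply, LieAlgebra.ad_apply,
        LieRing.of_associative_ring_bracket, LinearMap.sub_apply, map_sub, ih]
    congr 1
    exact ih (S x)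

theorem isChevalley_quot (Λ : Weight) : IsChevalley (quotH Λ) (quotE Λ) quotF where
  h_h x y := by
    ext l : 3
    exact congrArg serreSpan.mkQ (LinearMap.congr_fun ((isPreChevalley_word Λ).h_h x y) _)
  h_e x i := by
    ext l : 3
    exact congrArg serreSpan.mkQ (LinearMap.congr_fun ((isPreChevalley_word Λ).h_e x i) _)
  h_f x i := by
    ext l : 3
    exact congrArg serreSpan.mkQ (LinearMap.congr_fun ((isPreChevalley_word Λ).h_f x i) _)
  e_f_self i := by
    ext l : 3
    exact congrArg serreSpan.mkQ (LinearMap.congr_fun ((isPreChevalley_word Λ).e_f_self i) _)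
  e_f_ne i j hij := by
    ext l : 3
    exact congrArg serreSpan.mkQ (LinearMap.congr_fun ((isPreChevalley_word Λ).e_f_ne i j hij) _)
  serre_e i j hij := by
    ext l : 3
    refine (mapQ_ad_pow _ _ _ _).trans ?_
    rw [serre_wordE Λ hij]
    rfl
  serre_f i j hij := by
    ext l : 3
    refine (mapQ_ad_pow _ _ _ _).trans ?_
    exact (Submodule.Quotient.mk_eq_zero _).2 (mem_serreSpan [] hij _)

/-- The coefficient of the highest weight vector. -/
theorem exists_highest_coeff (Λ : Weight) : ∃ p : Verma Λ →ₗ[ℂ] ℂ,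
    p (Submodule.Quotient.mk 1) = 1 ∧ ∀ (i : Fin 2) (x : Verma Λ), p (uF i • x) = 0 := by
  have hc := isChevalley_quot Λ
  let φ := hc.algLift
  let _ : Module U WordQuot := Module.compHom WordQuot φ.toRingHom
  have smul_def : ∀ (u : U) (y : WordQuot), u • y = φ u y := fun _ _ => rfl
  have _ : IsScalarTower ℂ U WordQuot := ⟨fun a u y => by simp [smul_def]⟩
  let v : WordQuot := serreSpan.mkQ (Finsupp.single [] 1)
  -- The class of the empty word is singular of weight Λ, so the Verma module maps to the model; `p`
  -- is the empty-word coefficient of the image.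
  have hker : vermaIdeal Λ ≤ LinearMap.ker (LinearMap.toSpanSingleton U WordQuot v) := by
    refine Submodule.span_le.2 ?_
    rintro _ (⟨i, rfl⟩ | ⟨x, rfl⟩)
    · change φ (gen (freeE i)) v = 0
      rw [hc.algLift_gen, IsChevalley.freeLift_e]
      change serreSpan.mkQ (wordE Λ i (Finsupp.single [] 1)) = 0
      simp [wordEAux]
    · change φ (gen (freeH x) - algebraMap ℂ U (Λ x)) v = 0
      rw [map_sub, hc.algLift_gen, IsChevalley.freeLift_h, AlgHom.commutes, LinearMap.sub_apply,
        Module.algebraMap_end_apply, sub_eq_zero]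
      change serreSpan.mkQ (wordH Λ x (Finsupp.single [] 1)) = _
      rw [wordH_single, map_smul, rootSum_nil, sub_zero]
  let g : Verma Λ →ₗ[U] WordQuot := (vermaIdeal Λ).liftQ _ hker
  refine ⟨(serreSpan.liftQ nilCoeff serreSpan_le_ker) ∘ₗ g.restrictScalars ℂ, ?_, fun i x => ?_⟩
  · change serreSpan.liftQ nilCoeff serreSpan_le_ker (φ 1 v) = 1
    rw [map_one]
    change nilCoeff (Finsupp.single [] 1) = 1
    simp [nilCoeff]
  · change serreSpan.liftQ nilCoeff serreSpan_le_ker (g (uF i • x)) = 0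
    rw [map_smul, smul_def]
    change serreSpan.liftQ nilCoeff serreSpan_le_ker (hc.algLift (gen (freeF i)) (g x)) = 0
    rw [hc.algLift_gen, IsChevalley.freeLift_f]
    obtain ⟨y, hy⟩ := serreSpan.mkQ_surjective (g x)
    rw [← hy]
    exact nilCoeff_wordF i y

/-! ### Strings for an sl₂-triple of operators. -/

section String

variable {M : Type*} [AddCommGroup M] [Module ℂ M] {e f h : Module.End ℂ M}

theorem e_f_pow_succ (hef : ∀ x, e (f x) = f (e x) + h x) (hhf : ∀ x, h (f x) = f (h x) - (2 : ℂ) • f x)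
    {y : M} {μ : ℂ} (hy : h y = μ • y) (he : e y = 0) (n : ℕ) :
    h ((f ^ n) y) = (μ - 2 * n) • (f ^ n) y ∧
    e ((f ^ (n + 1)) y) = ((n + 1) * (μ - n)) • (f ^ n) y := by
  induction n with
  | zero => simp [hef, he, hy]
  | succ n ih =>
    have h1 : h ((f ^ (n + 1)) y) = (μ - 2 * (n + 1 : ℕ)) • (f ^ (n + 1)) y := by
      rw [pow_succ', Module.End.mul_apply, hhf, ih.1, map_smul, ← sub_smul]
      congr 1; push_cast; ring
    refine ⟨h1, ?_⟩
    rw [pow_succ' f (n + 1), Module.End.mul_apply, hef, ih.2, h1, map_smul,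
      ← Module.End.mul_apply, ← pow_succ', ← add_smul]
    congr 1; push_cast; ring

theorem h_e_pow (hhe : ∀ x, h (e x) = e (h x) + (2 : ℂ) • e x)
    {x : M} {μ : ℂ} (hx : h x = μ • x) (n : ℕ) :
    h ((e ^ n) x) = (μ + 2 * n) • (e ^ n) x := by
  induction n with
  | zero => simp [hx]
  | succ n ih =>
    rw [pow_succ', Module.End.mul_apply, hhe, ih, map_smul, ← add_smul]
    congr 1; push_cast; ring

/-- The string through a vector of nonnegative integral weight on which `e` is nilpotent. -/
theorem exists_string (hef : ∀ x, e (f x) = f (e x) + h x)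
    (hhf : ∀ x, h (f x) = f (h x) - (2 : ℂ) • f x) (hhe : ∀ x, h (e x) = e (h x) + (2 : ℂ) • e x)
    {x : M} {m : ℕ} (hx : h x = (m : ℂ) • x) (h0 : x ≠ 0) (hn : ∃ n, (e ^ n) x = 0) :
    ∃ p : ℕ, ∀ t ≤ m, (f ^ (p + t)) ((e ^ p) x) ≠ 0 := by
  classical
  obtain ⟨p, hp⟩ : ∃ p, Nat.find hn = p + 1 := by
    refine ⟨Nat.find hn - 1, ?_⟩
    have : Nat.find hn ≠ 0 := fun h => h0 (by simpa [h] using Nat.find_spec hn)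
    omega
  have hy0 : (e ^ p) x ≠ 0 := Nat.find_min hn (by omega)
  have hy1 : e ((e ^ p) x) = 0 := by
    rw [← Module.End.mul_apply, ← pow_succ', ← hp]; exact Nat.find_spec hn
  have hy := h_e_pow hhe hx p
  -- The last nonzero vector (e ^ p) x is killed by e and has weight m + 2p, so the coefficient (s +
  -- 1)(m + 2p − s) is nonzero for s < m + 2p.
  have key : ∀ s ≤ m + 2 * p, (f ^ s) ((e ^ p) x) ≠ 0 := by
    intro s
    induction s with
    | zero => exact fun _ => hy0
    | succ s ih =>
      intro hs hz
      have h1 := (e_f_pow_succ hef hhf hy hy1 s).2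
      rw [hz, map_zero] at h1
      have h2 := smul_eq_zero.1 h1.symm
      refine h2.elim (fun h3 => ?_) (ih (by omega))
      rcases mul_eq_zero.1 h3 with h4 | h4
      · exact Nat.cast_add_one_ne_zero s h4
      · have h5 : ((m + 2 * p : ℕ) : ℂ) = (s : ℕ) := by push_cast; linear_combination h4
        have h6 := Nat.cast_injective h5
        omega
  exact ⟨p, fun t ht => key _ (by omega)⟩

end String

/-! ### Modules over `U`: weight vectors, singular vectors, local nilpotency. -/

section Module

variable {M : Type*} [AddCommGroup M] [Module U M]

theorem uE_smul_uF_smul_self (i : Fin 2) (x : M) :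
    uE i • uF i • x = uF i • uE i • x + uH (simpleCoroot i) • x := by
  have := isChevalley_u.e_f_self i
  rw [LieRing.of_associative_ring_bracket, sub_eq_iff_eq_add] at this
  rw [smul_smul, this, add_smul, mul_smul, add_comm]

theorem uE_smul_uF_smul_ne {i j : Fin 2} (hij : i ≠ j) (x : M) :
    uE i • uF j • x = uF j • uE i • x := by
  have := isChevalley_u.e_f_ne i j hij
  rw [LieRing.of_associative_ring_bracket, sub_eq_zero] at this
  rw [smul_smul, this, mul_smul]

/-- By ac = [a, c] + ca, each of the n factors a either raises the exponent k of ad a or passes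
through to y. With n + k + 1 ≥ M₀ + r, either k reaches r or M₀ factors reach y. -/
theorem ad_nilpotent_smul {a b : U} {r : ℕ} (hr : ((LieAlgebra.ad ℂ U a) ^ r) b = 0) (n : ℕ) :
    ∀ (k M₀ : ℕ) (y : M), a ^ M₀ • y = 0 → M₀ + r ≤ n + k + 1 →
      a ^ n • (((LieAlgebra.ad ℂ U a) ^ k) b) • y = 0 := by
  have hz : ∀ k, r ≤ k → ((LieAlgebra.ad ℂ U a) ^ k) b = 0 := fun k hk => by
    obtain ⟨j, rfl⟩ := Nat.exists_eq_add_of_le' hk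
    rw [pow_add, Module.End.mul_apply, hr, map_zero]
  induction n with
  | zero =>
    intro k M₀ y hy hle
    rcases M₀ with _ | M₀
    · rw [pow_zero, one_smul] at hy; simp [hy]
    · rw [hz k (by omega)]; simp
  | succ n ih =>
    intro k M₀ y hy hle
    rcases M₀ with _ | M₀
    · rw [pow_zero, one_smul] at hy; simp [hy]
    · have h1 := ih (k + 1) (M₀ + 1) y hy (by omega)
      have h2 := ih k M₀ (a • y) (by rwa [smul_smul, ← pow_succ]) (by omega)
      rw [pow_succ', Module.End.mul_apply, LieAlgebra.ad_apply,
        LieRing.of_associative_ring_bracket, sub_smul, smul_sub, mul_smul, mul_smul, h2,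
        sub_zero, smul_smul, ← pow_succ] at h1
      exact h1

variable [Module ℂ M] [IsScalarTower ℂ U M]

theorem smul_smul_comm (a : ℂ) (u : U) (x : M) : u • a • x = a • u • x := by
  rw [← algebraMap_smul U a x, ← algebraMap_smul U a (u • x), smul_smul, smul_smul,
    Algebra.commutes]

/-- The action of an element of the enveloping algebra, as a linear map. -/
def act (M : Type*) [AddCommGroup M] [Module ℂ M] [Module U M] [IsScalarTower ℂ U M] :
    U →* Module.End ℂ M where
  toFun u :=
    { toFun := fun x => u • x
      map_add' := fun x y => smul_add u x y
      map_smul' := fun a x => smul_smul_comm a u x }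
  map_one' := by ext; simp
  map_mul' u w := by ext; simp [mul_smul]

@[simp] theorem act_apply (u : U) (x : M) : act M u x = u • x := rfl

theorem uH_smul_uE_smul (h : Cartan) (i : Fin 2) (x : M) :
    uH h • uE i • x = uE i • uH h • x + simpleRoot i h • uE i • x := by
  have := isChevalley_u.h_e h i
  rw [LieRing.of_associative_ring_bracket, sub_eq_iff_eq_add] at this
  rw [smul_smul, this, add_smul, mul_smul, add_comm, smul_assoc]

theorem uH_smul_uF_smul (h : Cartan) (i : Fin 2) (x : M) :
    uH h • uF i • x = uF i • uH h • x - simpleRoot i h • uF i • x := by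
  have := isChevalley_u.h_f h i
  rw [LieRing.of_associative_ring_bracket, sub_eq_iff_eq_add] at this
  rw [smul_smul, this, add_smul, mul_smul, neg_smul, smul_assoc]
  abel

/-- Vectors of weight `μ`. -/
def IsWt (μ : Weight) (x : M) : Prop := ∀ h : Cartan, uH h • x = μ h • x

theorem IsWt.uE_smul {μ : Weight} {x : M} (hx : IsWt μ x) (i : Fin 2) :
    IsWt (μ + simpleRoot i) (uE i • x) := fun h => by
  rw [uH_smul_uE_smul, hx, smul_smul_comm, ← add_smul]; rfl

theorem IsWt.uF_smul {μ : Weight} {x : M} (hx : IsWt μ x) (i : Fin 2) :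
    IsWt (μ - simpleRoot i) (uF i • x) := fun h => by
  rw [uH_smul_uF_smul, hx, smul_smul_comm, ← sub_smul]; rfl

theorem IsWt.uE_pow_smul {μ : Weight} {x : M} (hx : IsWt μ x) (i : Fin 2) (n : ℕ) :
    IsWt (μ + (n : ℂ) • simpleRoot i) (uE i ^ n • x) := by
  induction n with
  | zero => simpa using hx
  | succ n ih =>
    have := ih.uE_smul i
    rw [smul_smul, ← pow_succ'] at this
    convert this using 1
    push_cast; module

theorem IsWt.uF_pow_smul {μ : Weight} {x : M} (hx : IsWt μ x) (i : Fin 2) (n : ℕ) :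
    IsWt (μ - (n : ℂ) • simpleRoot i) (uF i ^ n • x) := by
  induction n with
  | zero => simpa using hx
  | succ n ih =>
    have := ih.uF_smul i
    rw [smul_smul, ← pow_succ'] at this
    convert this using 1
    push_cast; module

/-- The product of the `f i` along a word. -/
def fWord (l : List (Fin 2)) : U := (l.map uF).prod

@[simp] theorem fWord_nil : fWord [] = 1 := rfl

@[simp] theorem fWord_cons (i : Fin 2) (l : List (Fin 2)) : fWord (i :: l) = uF i * fWord l := by
  simp [fWord]

theorem IsWt.fWord_smul {μ : Weight} {x : M} (hx : IsWt μ x) (l : List (Fin 2)) :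
    IsWt (μ - rootSum l) (fWord l • x) := by
  induction l with
  | nil => simpa using hx
  | cons i l ih =>
    have := ih.uF_smul i
    rw [smul_smul, ← fWord_cons] at this
    convert this using 1
    rw [rootSum_cons]; abel

/-- Singular vectors of weight `Λ`. -/
structure IsSingular (Λ : Weight) (v : M) : Prop where
  isWt : IsWt Λ v
  uE_smul (i : Fin 2) : uE i • v = 0

theorem smul_mem_of_closed (S : Submodule ℂ M) (hh : ∀ h, ∀ x ∈ S, uH h • x ∈ S)
    (he : ∀ i, ∀ x ∈ S, uE i • x ∈ S) (hf : ∀ i, ∀ x ∈ S, uF i • x ∈ S) (u : U) :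
    ∀ x ∈ S, u • x ∈ S := by
  let B : Subalgebra ℂ U :=
    { carrier := {u | ∀ x ∈ S, u • x ∈ S}
      mul_mem' := fun {a b} ha hb x hx => by rw [mul_smul]; exact ha _ (hb x hx)
      add_mem' := fun {a b} ha hb x hx => by rw [add_smul]; exact add_mem (ha x hx) (hb x hx)
      algebraMap_mem' := fun a x hx => by rw [algebraMap_smul]; exact S.smul_mem a hx }
  have : u ∈ B := by rw [subalgebra_eq_top B hh he hf]; trivial
  exact this

theorem closed_of_span {s : Set M} {u : U}
    (h : ∀ x ∈ s, u • x ∈ Submodule.span ℂ s) : ∀ x ∈ Submodule.span ℂ s,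
    u • x ∈ Submodule.span ℂ s := fun _ hx =>
  (Submodule.span_le.2 h : Submodule.span ℂ s ≤ (Submodule.span ℂ s).comap (act M u)) hx

/-- The submodule generated by a singular vector is spanned by words in the `f i`. -/
theorem IsSingular.smul_mem_span {Λ : Weight} {v : M} (hv : IsSingular Λ v) (u : U) :
    u • v ∈ Submodule.span ℂ (Set.range fun l => fWord l • v) := by
  set S := Submodule.span ℂ (Set.range fun l => fWord l • v) with hS
  have mem : ∀ l, fWord l • v ∈ S := fun l => Submodule.subset_span ⟨l, rfl⟩
  have hh : ∀ h, ∀ x ∈ S, uH h • x ∈ S := fun h => closed_of_span <| by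
    rintro _ ⟨l, rfl⟩
    change uH h • fWord l • v ∈ S
    rw [hv.isWt.fWord_smul l h]
    exact S.smul_mem _ (mem l)
  have hf : ∀ i, ∀ x ∈ S, uF i • x ∈ S := fun i => closed_of_span <| by
    rintro _ ⟨l, rfl⟩
    change uF i • fWord l • v ∈ S
    rw [smul_smul, ← fWord_cons]
    exact mem (i :: l)
  have he : ∀ i, ∀ x ∈ S, uE i • x ∈ S := fun i => closed_of_span <| by
    rintro _ ⟨l, rfl⟩
    change uE i • fWord l • v ∈ S
    induction l with
    | nil => rw [fWord_nil, one_smul, hv.uE_smul]; exact zero_mem _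
    | cons j l ih =>
      rw [fWord_cons, mul_smul]
      by_cases hij : i = j
      · subst hij
        rw [uE_smul_uF_smul_self]
        exact add_mem (hf _ _ ih) (hh _ _ (mem l))
      · rw [uE_smul_uF_smul_ne hij]
        exact hf _ _ ih
  exact smul_mem_of_closed S hh he hf u v (by simpa using mem [])

theorem IsSingular.uE_smul_uF_pow_smul {Λ : Weight} {v : M} (hv : IsSingular Λ v) {i : Fin 2}
    {m : ℕ} (hm : Λ (simpleCoroot i) = m) :
    IsSingular (Λ - ((m + 1 : ℕ) : ℂ) • simpleRoot i) (uF i ^ (m + 1) • v) where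
  isWt := hv.isWt.uF_pow_smul i (m + 1)
  uE_smul k := by
    by_cases hk : k = i
    · subst hk
      have := (e_f_pow_succ (e := act M (uE k)) (f := act M (uF k))
        (h := act M (uH (simpleCoroot k))) (fun x => uE_smul_uF_smul_self k x)
        (fun x => by simpa [simpleRoot_coroot_self] using
          uH_smul_uF_smul (simpleCoroot k) k x) (hv.isWt (simpleCoroot k))
        (hv.uE_smul k) m).2
      rw [hm, sub_self, mul_zero, zero_smul, ← map_pow] at this
      exact this
    · have : ∀ n : ℕ, uE k • uF i ^ n • v = 0 := fun n => by
        induction n with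
        | zero => simpa using hv.uE_smul k
        | succ n ih => rw [pow_succ', mul_smul, uE_smul_uF_smul_ne hk, ih, smul_zero]
      exact this _

/-- An element of the Cartan subalgebra on which both simple roots take the value `1`. -/
def heightElt : Cartan := ![0, 1 / 2, 3]

theorem simpleRoot_heightElt (i : Fin 2) : simpleRoot i heightElt = 1 := by
  fin_cases i <;> (simp [simpleRoot, heightElt, α, δ]; try norm_num)

theorem rootSum_heightElt (l : List (Fin 2)) : rootSum l heightElt = l.length := by
  induction l with
  | nil => simp
  | cons i l ih => rw [rootSum_cons, LinearMap.add_apply, ih, simpleRoot_heightElt]; simp [add_comm]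

/-- A product of shifts of the height element, which annihilates the vectors of heights `1` to
`n` below `Λ`. -/
def heightProj (Λ : Weight) : ℕ → U
  | 0 => 1
  | n + 1 => (uH heightElt - algebraMap ℂ U (Λ heightElt - (n + 1 : ℕ))) * heightProj Λ n

theorem heightProj_smul (Λ : Weight) {μ : Weight} {x : M} (hx : IsWt μ x) (n : ℕ) :
    heightProj Λ n • x =
      (∏ k ∈ Finset.range n, (μ heightElt - Λ heightElt + (k + 1 : ℕ))) • x := by
  induction n with
  | zero => simp [heightProj]
  | succ n ih =>
    rw [heightProj, mul_smul, ih, sub_smul, smul_smul_comm, hx, algebraMap_smul, ← smul_assoc,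
      ← smul_assoc, ← sub_smul, Finset.prod_range_succ]
    congr 1; simp only [smul_eq_mul]; ring

/-- On a vector of height d below Λ, `heightProj Λ N` is the product of the k + 1 − d for k < N:
zero if 1 ≤ d ≤ N, and N! if d = 0. For large N only the top component remains, and `q` reads off
its coefficient. -/
theorem IsSingular.heightProj_smul_eq {Λ : Weight} {v : M} (hv : IsSingular Λ v) {q : M →ₗ[ℂ] ℂ}
    (hq1 : q v = 1) (hqf : ∀ i x, q (uF i • x) = 0) {x : M}
    (hx : x ∈ Submodule.span ℂ (Set.range fun l => fWord l • v)) :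
    ∃ N₀, ∀ N ≥ N₀, heightProj Λ N • x = (q x * N.factorial) • v := by
  induction hx using Submodule.span_induction with
  | mem x hx =>
    obtain ⟨l, rfl⟩ := hx
    refine ⟨l.length, fun N hN => ?_⟩
    dsimp only
    rw [heightProj_smul Λ (hv.isWt.fWord_smul l)]
    cases l with
    | nil =>
      rw [fWord_nil, one_smul, hq1, one_mul, ← Finset.prod_range_add_one_eq_factorial,
        Nat.cast_prod]
      simp
    | cons i l =>
      rw [fWord_cons, mul_smul, hqf, zero_mul, zero_smul, smul_eq_zero, Finset.prod_eq_zero_iff]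
      left
      refine ⟨l.length, Finset.mem_range.2 (by simpa using hN), ?_⟩
      rw [LinearMap.sub_apply, rootSum_heightElt]; simp
  | zero => exact ⟨0, fun N _ => by simp⟩
  | add x y _ _ hx hy =>
    obtain ⟨a, ha⟩ := hx
    obtain ⟨b, hb⟩ := hy
    refine ⟨max a b, fun N hN => ?_⟩
    rw [smul_add, ha N (le_of_max_le_left hN), hb N (le_of_max_le_right hN), map_add, add_mul,
      add_smul]
  | smul a x _ hx =>
    obtain ⟨b, hb⟩ := hx
    refine ⟨b, fun N hN => ?_⟩
    rw [smul_smul_comm, hb N hN, map_smul, smul_eq_mul, mul_assoc, mul_smul a]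

/-- The weights of a module generated by a singular vector of weight `Λ`. -/
theorem IsSingular.exists_rootSum {Λ μ : Weight} {v x : M} (hv : IsSingular Λ v)
    (hx : x ∈ Submodule.span ℂ (Set.range fun l => fWord l • v)) (hμ : IsWt μ x) (h0 : x ≠ 0) :
    ∃ l, μ = Λ - rootSum l := by
  classical
  by_contra! hne
  -- A product of operators h − ν(h) kills any finite set of words of weight ν ≠ μ but only rescales
  -- `x` by a nonzero scalar. Applied to the words occurring in `x`, it gives a contradiction.
  have key : ∀ s : Finset (List (Fin 2)), ∃ u : U, (∀ l ∈ s, u • fWord l • v = 0) ∧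
      ∃ z : ℂ, z ≠ 0 ∧ u • x = z • x := by
    intro s
    induction s using Finset.induction_on with
    | empty => exact ⟨1, by simp, 1, one_ne_zero, by simp⟩
    | insert l s _ ih =>
      obtain ⟨u, hu, z, hz, hux⟩ := ih
      obtain ⟨h, hh⟩ : ∃ h, μ h ≠ (Λ - rootSum l) h := by
        by_contra! hc
        exact hne l (LinearMap.ext hc)
      refine ⟨u * (uH h - algebraMap ℂ U ((Λ - rootSum l) h)), fun l' hl' => ?_,
        (μ h - (Λ - rootSum l) h) * z, mul_ne_zero (sub_ne_zero.2 hh) hz, ?_⟩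
      · rw [mul_smul, sub_smul, algebraMap_smul, hv.isWt.fWord_smul l' h, ← sub_smul]
        rcases Finset.mem_insert.1 hl' with rfl | hl'
        · simp
        · rw [smul_smul_comm, hu l' hl', smul_zero]
      · rw [mul_smul, sub_smul, algebraMap_smul, hμ h, ← sub_smul, smul_smul_comm, hux, mul_smul]
  obtain ⟨c, rfl⟩ := Finsupp.mem_span_range_iff_exists_finsupp.1 hx
  obtain ⟨u, hu, z, hz, hux⟩ := key c.support
  refine smul_ne_zero hz h0 (hux.symm.trans ?_)
  rw [Finsupp.sum, Finset.smul_sum]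
  refine Finset.sum_eq_zero fun l hl => ?_
  rw [smul_smul_comm, hu l hl, smul_zero]

/-- Local nilpotency of `f i`, given nilpotency on a generating singular vector. -/
theorem exists_uF_pow_smul {v : M} {i : Fin 2} (hv : ∃ N : ℕ, uF i ^ N • v = 0) {x : M}
    (hx : x ∈ Submodule.span ℂ (Set.range fun l => fWord l • v)) : ∃ N : ℕ, uF i ^ N • x = 0 := by
  have mono : ∀ {y : M} {N N' : ℕ}, uF i ^ N • y = 0 → N ≤ N' → uF i ^ N' • y = 0 :=
    fun {y N N'} h hle => by
      obtain ⟨j, rfl⟩ := Nat.exists_eq_add_of_le' hle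
      rw [pow_add, mul_smul, h, smul_zero]
  induction hx using Submodule.span_induction with
  | mem x hx =>
    obtain ⟨l, rfl⟩ := hx
    dsimp only
    induction l with
    | nil => simpa using hv
    | cons j l ih =>
      obtain ⟨N, hN⟩ := ih
      rw [fWord_cons, mul_smul]
      by_cases hij : i = j
      · subst hij
        exact ⟨N, by rw [smul_smul, ← pow_succ, pow_succ', mul_smul, hN, smul_zero]⟩
      · have := ad_nilpotent_smul (isChevalley_u.serre_f i j hij)
          (N + (1 - gcm i j).toNat) 0 N (fWord l • v) hN (by omega)
        exact ⟨_, this⟩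
  | zero => exact ⟨0, by simp⟩
  | add x y _ _ hx hy =>
    obtain ⟨a, ha⟩ := hx
    obtain ⟨b, hb⟩ := hy
    exact ⟨max a b, by rw [smul_add, mono ha (le_max_left a b), mono hb (le_max_right a b),
      add_zero]⟩
  | smul a x _ hx =>
    obtain ⟨b, hb⟩ := hx
    exact ⟨b, by rw [smul_smul_comm, hb, smul_zero]⟩

end Module

/-! ### The irreducible module -/

def vermaVec (Λ : Weight) : Verma Λ := Submodule.Quotient.mk 1

theorem isSingular_vermaVec (Λ : Weight) : IsSingular Λ (vermaVec Λ) where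
  isWt h := by
    rw [← algebraMap_smul U, ← sub_eq_zero, ← sub_smul]
    change Submodule.Quotient.mk ((uH h - algebraMap ℂ U (Λ h)) • (1 : U)) = 0
    rw [Submodule.Quotient.mk_eq_zero, smul_eq_mul, mul_one]
    exact Submodule.subset_span (Or.inr ⟨h, rfl⟩)
  uE_smul i := by
    change Submodule.Quotient.mk (uE i • (1 : U)) = 0
    rw [Submodule.Quotient.mk_eq_zero, smul_eq_mul, mul_one]
    exact Submodule.subset_span (Or.inl ⟨i, rfl⟩)

theorem exists_smul_vermaVec {Λ : Weight} (x : Verma Λ) : ∃ u : U, x = u • vermaVec Λ := by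
  obtain ⟨u, rfl⟩ := Submodule.Quotient.mk_surjective _ x
  refine ⟨u, ?_⟩
  change _ = Submodule.Quotient.mk (u • (1 : U))
  rw [smul_eq_mul, mul_one]

theorem mem_span_vermaVec {Λ : Weight} (x : Verma Λ) :
    x ∈ Submodule.span ℂ (Set.range fun l => fWord l • vermaVec Λ) := by
  obtain ⟨u, rfl⟩ := exists_smul_vermaVec x
  exact (isSingular_vermaVec Λ).smul_mem_span u

/-- The largest submodule on which the coefficient of the highest weight vector vanishes. -/
def coeffKernel {Λ : Weight} (q : Verma Λ →ₗ[ℂ] ℂ) : Submodule U (Verma Λ) where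
  carrier := {x | ∀ u : U, q (u • x) = 0}
  add_mem' hx hy u := by rw [smul_add, map_add, hx u, hy u, add_zero]
  zero_mem' u := by simp
  smul_mem' w x hx u := by rw [smul_smul]; exact hx _

/-- A submodule containing a vector with nonzero highest coefficient contains, by `heightProj`, a
nonzero multiple of the generator, so it is everything. Conversely the generator is not in
`coeffKernel q`. -/
theorem maxProper_eq {Λ : Weight} {q : Verma Λ →ₗ[ℂ] ℂ} (hq1 : q (vermaVec Λ) = 1)
    (hqf : ∀ i x, q (uF i • x) = 0) : maxProper Λ = coeffKernel q := by
  refine le_antisymm (sSup_le fun N hN x hx u => ?_) (le_sSup fun h => ?_)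
  · by_contra h0
    obtain ⟨n, hn⟩ := (isSingular_vermaVec Λ).heightProj_smul_eq hq1 hqf
      (mem_span_vermaVec (u • x))
    have h1 : heightProj Λ n • u • x ∈ N := N.smul_mem _ (N.smul_mem _ hx)
    rw [hn n le_rfl] at h1
    set a := q (u • x) * n.factorial with ha
    have ha0 : a ≠ 0 := mul_ne_zero h0 (by exact_mod_cast n.factorial_ne_zero)
    have h2 : vermaVec Λ ∈ N := by
      have := N.smul_mem (algebraMap ℂ U a⁻¹) h1
      rwa [algebraMap_smul, smul_smul, inv_mul_cancel₀ ha0, one_smul] at this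
    refine hN (eq_top_iff.2 fun y _ => ?_)
    obtain ⟨w, rfl⟩ := exists_smul_vermaVec y
    exact N.smul_mem w h2
  · have h1 : vermaVec Λ ∈ coeffKernel q := h ▸ trivial
    have h2 := h1 1
    rw [one_smul, hq1] at h2
    exact one_ne_zero h2

def highestVec (Λ : Weight) : L Λ := Submodule.Quotient.mk (vermaVec Λ)

theorem isSingular_highestVec (Λ : Weight) : IsSingular Λ (highestVec Λ) where
  isWt h := congrArg (maxProper Λ).mkQ ((isSingular_vermaVec Λ).isWt h)
  uE_smul i := by
    have := congrArg (maxProper Λ).mkQ ((isSingular_vermaVec Λ).uE_smul i)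
    rwa [map_zero] at this

theorem mem_span_highestVec {Λ : Weight} (x : L Λ) :
    x ∈ Submodule.span ℂ (Set.range fun l => fWord l • highestVec Λ) := by
  obtain ⟨y, rfl⟩ := Submodule.Quotient.mk_surjective _ x
  obtain ⟨u, rfl⟩ := exists_smul_vermaVec y
  exact (isSingular_highestVec Λ).smul_mem_span u

theorem highestVec_ne_zero (Λ : Weight) : highestVec Λ ≠ 0 := by
  obtain ⟨q, hq1, hqf⟩ := exists_highest_coeff Λ
  intro h
  rw [highestVec, Submodule.Quotient.mk_eq_zero, maxProper_eq hq1 hqf] at h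
  have h2 := h 1
  rw [one_smul] at h2
  exact one_ne_zero (hq1.symm.trans h2)

/-- In the Verma module this vector is singular, so it generates only f-words applied to itself. All
of these have highest coefficient zero, hence lie in `maxProper Λ`. -/
theorem uF_pow_smul_highestVec {Λ : Weight} {i : Fin 2} {m : ℕ} (hm : Λ (simpleCoroot i) = m) :
    uF i ^ (m + 1) • highestVec Λ = 0 := by
  obtain ⟨q, hq1, hqf⟩ := exists_highest_coeff Λ
  change Submodule.Quotient.mk (uF i ^ (m + 1) • vermaVec Λ) = 0
  rw [Submodule.Quotient.mk_eq_zero, maxProper_eq hq1 hqf]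
  intro u
  have hs := (isSingular_vermaVec Λ).uE_smul_uF_pow_smul hm
  have : Submodule.span ℂ (Set.range fun l => fWord l • uF i ^ (m + 1) • vermaVec Λ) ≤
      LinearMap.ker q := by
    refine Submodule.span_le.2 ?_
    rintro _ ⟨l, rfl⟩
    change q (fWord l • uF i ^ (m + 1) • vermaVec Λ) = 0
    cases l with
    | nil => rw [fWord_nil, one_smul, pow_succ', mul_smul, hqf]
    | cons j l => rw [fWord_cons, mul_smul, hqf]
  exact this (hs.smul_mem_span u)

theorem mem_P_iff {Λ μ : Weight} : μ ∈ P Λ ↔ ∃ x : L Λ, x ≠ 0 ∧ IsWt μ x := by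
  simp only [P, IsWt, Set.mem_ofPred_eq, algebraMap_smul, gen_freeH]

theorem highest_mem_P (Λ : Weight) : Λ ∈ P Λ :=
  mem_P_iff.2 ⟨highestVec Λ, highestVec_ne_zero Λ, (isSingular_highestVec Λ).isWt⟩

theorem exists_rootSum_of_mem_P {Λ μ : Weight} (hμ : μ ∈ P Λ) : ∃ l, μ = Λ - rootSum l := by
  obtain ⟨x, h0, hx⟩ := mem_P_iff.1 hμ
  exact (isSingular_highestVec Λ).exists_rootSum (mem_span_highestVec x) hx h0

/-- No weight lies higher than Λ, so the height bounds the powers of e_i. -/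
theorem exists_uE_pow_smul {Λ μ : Weight} {x : L Λ} (hx : IsWt μ x) (i : Fin 2) :
    ∃ n : ℕ, uE i ^ n • x = 0 := by
  by_contra! hne
  have h0 : x ≠ 0 := by simpa using hne 0
  obtain ⟨l, hl⟩ := exists_rootSum_of_mem_P (mem_P_iff.2 ⟨x, h0, hx⟩)
  obtain ⟨l', hl'⟩ := exists_rootSum_of_mem_P
    (mem_P_iff.2 ⟨_, hne (l.length + 1), hx.uE_pow_smul i (l.length + 1)⟩)
  have h1 := congrArg (fun ν : Weight => ν heightElt) hl'
  simp only [hl, LinearMap.sub_apply, LinearMap.add_apply, LinearMap.smul_apply,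
    rootSum_heightElt, simpleRoot_heightElt] at h1
  have h2 : ((l'.length + 1 : ℕ) : ℂ) = 0 := by
    push_cast at h1 ⊢
    simp only [smul_eq_mul] at h1
    linear_combination h1
  exact Nat.succ_ne_zero _ (Nat.cast_eq_zero.1 h2)

/-- Weight strings in the direction of `-α_i`. -/
theorem sub_mem_P {Λ μ : Weight} (hμ : μ ∈ P Λ) {i : Fin 2} {m t : ℕ}
    (hm : μ (simpleCoroot i) = m) (ht : t ≤ m) : μ - (t : ℂ) • simpleRoot i ∈ P Λ := by
  obtain ⟨x, h0, hx⟩ := mem_P_iff.1 hμ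
  obtain ⟨n, hn⟩ := exists_uE_pow_smul hx i
  obtain ⟨p, hp⟩ := exists_string (e := act (L Λ) (uE i)) (f := act (L Λ) (uF i))
    (h := act (L Λ) (uH (simpleCoroot i))) (fun x => uE_smul_uF_smul_self i x)
    (fun x => by simpa [simpleRoot_coroot_self] using uH_smul_uF_smul (simpleCoroot i) i x)
    (fun x => by simpa [simpleRoot_coroot_self] using uH_smul_uE_smul (simpleCoroot i) i x)
    (x := x) (m := m) (by rw [← hm]; exact hx _) h0 ⟨n, by rw [← map_pow]; exact hn⟩
  have h1 := hp t ht
  rw [← map_pow, ← map_pow] at h1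
  refine mem_P_iff.2 ⟨_, h1, ?_⟩
  have h2 := (hx.uE_pow_smul i p).uF_pow_smul i (p + t)
  convert h2 using 1
  · push_cast; module
  · rfl

/-- Weight strings in the direction of `α_i`. -/
theorem add_mem_P {Λ μ : Weight} (hμ : μ ∈ P Λ) {i : Fin 2} {m t k : ℕ}
    (hk : Λ (simpleCoroot i) = k) (hm : μ (simpleCoroot i) = -m) (ht : t ≤ m) :
    μ + (t : ℂ) • simpleRoot i ∈ P Λ := by
  obtain ⟨x, h0, hx⟩ := mem_P_iff.1 hμ
  obtain ⟨n, hn⟩ := exists_uF_pow_smul ⟨_, uF_pow_smul_highestVec hk⟩ (mem_span_highestVec x)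
  -- The same string lemma for the opposite triple (f, e, −h).
  obtain ⟨p, hp⟩ := exists_string (e := act (L Λ) (uF i)) (f := act (L Λ) (uE i))
    (h := -act (L Λ) (uH (simpleCoroot i)))
    (fun x => by
      have := uE_smul_uF_smul_self i x
      simp only [act_apply, LinearMap.neg_apply, this]; abel)
    (fun x => by
      have := uH_smul_uE_smul (simpleCoroot i) i x
      simp only [act_apply, LinearMap.neg_apply, this, smul_neg, simpleRoot_coroot_self]; abel)
    (fun x => by
      have := uH_smul_uF_smul (simpleCoroot i) i x
      simp only [act_apply, LinearMap.neg_apply, this, smul_neg, simpleRoot_coroot_self]; abel)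
    (x := x) (m := m) (by
      have := hx (simpleCoroot i)
      rw [hm] at this
      rw [LinearMap.neg_apply, act_apply, this, neg_smul, neg_neg]) h0
    ⟨n, by rw [← map_pow]; exact hn⟩
  have h1 := hp t ht
  rw [← map_pow, ← map_pow] at h1
  refine mem_P_iff.2 ⟨_, h1, ?_⟩
  have h2 := (hx.uF_pow_smul i p).uE_pow_smul i (p + t)
  convert h2 using 1
  · push_cast; module
  · rfl

/-! ### Combinatorics of weight strings -/

/-- The properties of the set of pairs `(j, n)` for which `aω₀ + bω₁ + jα + nδ` is a weight. -/
structure IsStringClosed (a b : ℤ) (E : ℤ → ℤ → Prop) : Prop where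
  pos : 0 < 2 * a + b
  top : E 0 0
  le_zero {j n : ℤ} : E j n → n ≤ 0
  string_one {j n i : ℤ} : E j n → (j ≤ i ∧ i ≤ -b - j) ∨ (-b - j ≤ i ∧ i ≤ j) → E i n
  string_zero {j n r : ℤ} : E j n → (0 ≤ r ∧ r ≤ a - j) ∨ (a - j ≤ r ∧ r ≤ 0) →
    E (j + 2 * r) (n - r)

/-- `n` is the largest number paired with `j`. -/
def IsMaxAt (E : ℤ → ℤ → Prop) (j n : ℤ) : Prop := E j n ∧ ∀ m, E j m → m ≤ n

namespace IsStringClosed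

variable {a b : ℤ} {E : ℤ → ℤ → Prop}

/-- Reflecting in α₁, if j is not already on the left, and then in α₀ raises |2j + b| by 2(2a + b),
which is positive because the level is. -/
theorem exists_large (hE : IsStringClosed a b E) (N : ℕ) :
    ∃ j n, E j n ∧ (N : ℤ) ≤ |2 * j + b| := by
  induction N with
  | zero => exact ⟨0, 0, hE.top, by simp⟩
  | succ N ih =>
    obtain ⟨j, n, h, hN⟩ := ih
    obtain ⟨i, hi, hi'⟩ : ∃ i, E i n ∧ 2 * i + b ≤ -N := by
      rcases abs_cases (2 * j + b) with ⟨h1, h2⟩ | ⟨h1, h2⟩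
      · exact ⟨-b - j, hE.string_one h (by omega), by omega⟩
      · exact ⟨j, h, by omega⟩
    have h0 := hE.string_zero (r := a - i) hi (by omega)
    have hp := hE.pos
    refine ⟨_, _, h0, le_trans ?_ (le_abs_self _)⟩
    push_cast; omega

theorem exists_isMaxAt (hE : IsStringClosed a b E) (j : ℤ) : ∃ n, IsMaxAt E j n := by
  classical
  obtain ⟨i, n, h, hN⟩ := hE.exists_large (2 * j + b).natAbs
  -- The α₁-string of a position far from the centre −b/2 covers every position closer to it.
  have hj : E j n := hE.string_one h (by
    rw [Int.natCast_natAbs] at hN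
    rcases abs_cases (2 * j + b) with ⟨h1, h2⟩ | ⟨h1, h2⟩ <;>
      rcases abs_cases (2 * i + b) with ⟨h3, h4⟩ | ⟨h3, h4⟩ <;> omega)
  obtain ⟨m, hm, hmax⟩ := Int.exists_greatest_of_bdd (P := E j) ⟨0, fun z hz => hE.le_zero hz⟩
    ⟨n, hj⟩
  exact ⟨m, hm, hmax⟩

/-- Comparison of two positions with respect to the reflection in `α₀`. -/
theorem exists_of_between (hE : IsStringClosed a b E) {q m p : ℤ} (h : E q m)
    (hp : (q ≤ p ∧ p ≤ 2 * a - q) ∨ (2 * a - q ≤ p ∧ p ≤ q)) :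
    ∃ n, E p n ∧ 2 * m + q ≤ 2 * n + p + 1 := by
  rcases Int.even_or_odd' (p - q) with ⟨r, hr | hr⟩
  · have := hE.string_zero (r := r) h (by omega)
    exact ⟨m - r, by convert this using 1; omega, by omega⟩
  -- The α₀-string moves in steps of 2. For odd p − q, stop at a neighbour of p farther from −b/2
  -- and take one α₁-step inwards; this costs at most 1 in 2n + p.
  · by_cases h0 : 0 ≤ 2 * p + b
    · have := hE.string_zero (r := r + 1) h (by omega)
      exact ⟨_, hE.string_one this (i := p) (by omega), by omega⟩
    · have := hE.string_zero (r := r) h (by omega)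
      exact ⟨_, hE.string_one this (i := p) (by omega), by omega⟩

/-- Let K = 2m₀'' + m₁'' + 3. For t < 0 the α₁-string of the given weight contains J at the same n.
For t > 0, J lies within the α₀-range, where n drops by at most (Kt + 1)/2, no more than the
quadratic term in S. -/
theorem exists_even_bound (hE : IsStringClosed a b E) {m₀ m₁ m₀'' m₁'' J t n S : ℤ} (hm₀ : 0 ≤ m₀)
    (hm₁ : 0 ≤ m₁) (hm₀'' : 0 ≤ m₀'') (hm₁'' : 0 ≤ m₁'')
    (hlev : 2 * m₀ + m₁ = 2 * a + b + (2 * m₀'' + m₁'')) (hJ : 2 * J + b = m₁ - m₁'')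
    (h : E (J - (2 * m₀'' + m₁'' + 3) * t) n)
    (hS : 2 * S = 2 * n - (m₁'' + 1) * t - (2 * m₀'' + m₁'' + 3) * t ^ 2) :
    ∃ n', E J n' ∧ S ≤ n' := by
  rcases lt_trichotomy t 0 with ht | rfl | ht
  · obtain ⟨s, rfl⟩ : ∃ s, t = -s := ⟨-t, by ring⟩
    have hs : 1 ≤ s := by omega
    have h1 : 2 * m₀'' + m₁'' + 3 ≤ (2 * m₀'' + m₁'' + 3) * s := by nlinarith
    have h2 : (m₁'' + 1) * s ≤ (2 * m₀'' + m₁'' + 3) * s ^ 2 := by nlinarith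
    rw [mul_neg] at h
    refine ⟨n, hE.string_one h (by omega), ?_⟩
    rw [mul_neg, neg_sq] at hS
    omega
  · exact ⟨n, by simpa using h, by simp at hS; omega⟩
  · have h1 : 2 * m₀'' + m₁'' + 3 ≤ (2 * m₀'' + m₁'' + 3) * t := by nlinarith
    have h2 : (2 * m₀'' + m₁'' + 3) * t + 1 ≤ (m₁'' + 1) * t + (2 * m₀'' + m₁'' + 3) * t ^ 2 := by
      nlinarith
    obtain ⟨n', hn', hle⟩ := hE.exists_of_between h (p := J) (by omega)
    exact ⟨n', hn', by omega⟩

/-- The same two moves, now to t = 0 (for t ≤ 0, along α₁) or to t = 1 (for t ≥ 1, by the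
α₀-comparison). The shift m₀'' + 1 is the value of the quadratic at t = 1. -/
theorem exists_odd_bound (hE : IsStringClosed a b E) {m₀ m₁ m₀'' m₁'' Z t n S : ℤ} (hm₀ : 0 ≤ m₀)
    (hm₁ : 0 ≤ m₁) (hm₀'' : 0 ≤ m₀'') (hm₁'' : 0 ≤ m₁'')
    (hlev : 2 * m₀ + m₁ = 2 * a + b + (2 * m₀'' + m₁'')) (hZ : 2 * Z + b = m₁ + m₁'' + 2)
    (h : E (Z - (2 * m₀'' + m₁'' + 3) * t) n)
    (hS : 2 * S = 2 * n + (m₁'' + 1) * t - (2 * m₀'' + m₁'' + 3) * t ^ 2) :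
    (∃ n', E Z n' ∧ S ≤ n') ∨
      ∃ n', E (Z - (2 * m₀'' + m₁'' + 3)) n' ∧ S ≤ n' - m₀'' - 1 := by
  rcases le_or_gt t 0 with ht | ht
  · left
    obtain ⟨s, rfl⟩ : ∃ s, t = -s := ⟨-t, by ring⟩
    have hs : 0 ≤ s := by omega
    have h1 : 0 ≤ (2 * m₀'' + m₁'' + 3) * s := by positivity
    have h2 : 0 ≤ (m₁'' + 1) * s + (2 * m₀'' + m₁'' + 3) * s ^ 2 := by positivity
    rw [mul_neg] at h
    refine ⟨n, hE.string_one h (by omega), ?_⟩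
    rw [mul_neg, neg_sq] at hS
    omega
  · right
    obtain ⟨s, rfl⟩ : ∃ s, t = s + 1 := ⟨t - 1, by ring⟩
    rcases (show 0 ≤ s by omega).eq_or_lt with rfl | hs
    · exact ⟨n, by simpa using h, by simp at hS; omega⟩
    · have h1 : 0 ≤ (2 * m₀'' + m₁'' + 3) * s := by positivity
      have h2 : (2 * m₀'' + m₁'' + 3) * s + 1 ≤
          (2 * m₀'' + m₁'' + 3) * (2 * s + s ^ 2) - (m₁'' + 1) * s := by nlinarith
      obtain ⟨n', hn', hle⟩ := hE.exists_of_between h (p := Z - (2 * m₀'' + m₁'' + 3)) (by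
        rw [mul_add]; omega)
      refine ⟨n', hn', ?_⟩
      have h3 : (2 * m₀'' + m₁'' + 3) * (s + 1) = (2 * m₀'' + m₁'' + 3) * s +
        (2 * m₀'' + m₁'' + 3) := by ring
      have h4 : (2 * m₀'' + m₁'' + 3) * (s + 1) ^ 2 =
        (2 * m₀'' + m₁'' + 3) * (2 * s + s ^ 2) + (2 * m₀'' + m₁'' + 3) := by ring
      have h5 : (m₁'' + 1) * (s + 1) = (m₁'' + 1) * s + (m₁'' + 1) := by ring
      omega

theorem isMaxAt_reflect_one (hE : IsStringClosed a b E) {j n : ℤ} (h : IsMaxAt E j n) :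
    IsMaxAt E (-b - j) n :=
  ⟨hE.string_one h.1 (by omega), fun m hm => h.2 m (hE.string_one hm (by omega))⟩

theorem isMaxAt_reflect_zero (hE : IsStringClosed a b E) {j n : ℤ} (h : IsMaxAt E j n) :
    IsMaxAt E (2 * a - j) (n - (a - j)) := by
  have h1 : ∀ {j n : ℤ}, E j n → E (2 * a - j) (n - (a - j)) := fun {j n} h => by
    have := hE.string_zero (r := a - j) h (by omega)
    convert this using 1; ring
  refine ⟨h1 h.1, fun m hm => ?_⟩
  have h2 := h1 hm
  rw [sub_sub_cancel] at h2
  have := h.2 _ h2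
  omega

end IsStringClosed

/-! ### Coordinates on the weights -/

/-- The weight `kω₀ + xα + nδ`. -/
def pt (k x n : ℂ) : Weight := k • ω₀ + x • α + n • δ

theorem pt_inj {k x n k' x' n' : ℂ} : pt k x n = pt k' x' n' ↔ k = k' ∧ x = x' ∧ n = n' := by
  refine ⟨fun h => ⟨?_, ?_, ?_⟩, fun ⟨h1, h2, h3⟩ => by rw [h1, h2, h3]⟩
  · simpa [pt, ω₀, α, δ, c] using LinearMap.congr_fun h c
  · simpa [pt, ω₀, α, δ, αv] using LinearMap.congr_fun h αv
  · simpa [pt, ω₀, α, δ, d] using LinearMap.congr_fun h d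

theorem pt_add (k x n k' x' n' : ℂ) : pt k x n + pt k' x' n' = pt (k + k') (x + x') (n + n') := by
  simp only [pt]; module

theorem pt_sub (k x n k' x' n' : ℂ) : pt k x n - pt k' x' n' = pt (k - k') (x - x') (n - n') := by
  simp only [pt]; module

theorem smul_α_eq (x : ℂ) : x • α = pt 0 x 0 := by simp only [pt]; module

theorem smul_δ_eq (n : ℂ) : n • δ = pt 0 0 n := by simp only [pt]; module

theorem zsmul_δ_eq (n : ℤ) : n • δ = pt 0 0 n := by
  rw [← smul_δ_eq, Int.cast_smul_eq_zsmul]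

theorem zsmul_α_eq (n : ℤ) : n • α = pt 0 n 0 := by
  rw [← smul_α_eq, Int.cast_smul_eq_zsmul]

theorem wt_eq (m₀ m₁ : ℕ) : wt m₀ m₁ = pt (m₀ + m₁ / 2) (m₁ / 2) 0 := by
  simp only [wt, ω₁, pt]; module

theorem ρ_eq : ρ = pt (3 / 2) (1 / 2) 0 := by
  simp only [ρ, ω₁, pt]; module

theorem pt_c (k x n : ℂ) : pt k x n c = k := by simp [pt, ω₀, α, δ, c]

theorem pt_coroot_zero (k x n : ℂ) : pt k x n (simpleCoroot 0) = k - x := by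
  simp [pt, simpleCoroot, ω₀, α, δ, c, αv]; ring

theorem pt_coroot_one (k x n : ℂ) : pt k x n (simpleCoroot 1) = 2 * x := by
  simp [pt, simpleCoroot, ω₀, α, δ, αv]; ring

theorem smul_simpleRoot_zero (a : ℂ) : a • simpleRoot 0 = pt 0 (-2 * a) a := by
  simp only [simpleRoot, pt, Matrix.cons_val_zero]; module

theorem smul_simpleRoot_one (a : ℂ) : a • simpleRoot 1 = pt 0 a 0 := by
  simp only [simpleRoot, pt, Matrix.cons_val_one]; simp

theorem s_apply (i : Fin 2) (μ : Weight) : s i μ = μ - μ (simpleCoroot i) • simpleRoot i := by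
  rw [s, Module.reflection_apply, Module.Dual.eval_apply]

theorem s_zero_pt (k x n : ℂ) : s 0 (pt k x n) = pt k (2 * k - x) (n - (k - x)) := by
  rw [s_apply, pt_coroot_zero, smul_simpleRoot_zero, pt_sub, pt_inj]
  exact ⟨by ring, by ring, by ring⟩

theorem s_one_pt (k x n : ℂ) : s 1 (pt k x n) = pt k (-x) n := by
  rw [s_apply, pt_coroot_one, smul_simpleRoot_one, pt_sub, pt_inj]
  exact ⟨by ring, by ring, by ring⟩

/-! ### The Weyl group in coordinates -/

theorem exists_word {v : Weight ≃ₗ[ℂ] Weight} (hv : v ∈ W) :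
    ∃ l : List (Fin 2), (l.map s).prod = v := by
  induction hv using Subgroup.closure_induction with
  | mem x hx =>
    obtain ⟨i, rfl⟩ := hx
    exact ⟨[i], by simp⟩
  | one => exact ⟨[], rfl⟩
  | mul x y _ _ hx hy =>
    obtain ⟨l, rfl⟩ := hx
    obtain ⟨l', rfl⟩ := hy
    exact ⟨l ++ l', by simp⟩
  | inv x _ hx =>
    obtain ⟨l, rfl⟩ := hx
    refine ⟨l.reverse, ?_⟩
    rw [List.prod_inv_reverse, List.map_reverse, List.map_map]
    congr 3

theorem s_mem_W (i : Fin 2) : s i ∈ W := Subgroup.subset_closure ⟨i, rfl⟩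

/-- `v` acts as a reflection or translation with sign `σ` and displacement `t`. -/
def ActsAs (v : Weight ≃ₗ[ℂ] Weight) (σ t : ℤ) : Prop :=
  ∀ k x n : ℂ, v (pt k x n) = pt k (σ * x + 2 * k * t) (n - σ * x * t - k * t ^ 2)

theorem word_actsAs (l : List (Fin 2)) : ∃ t, ActsAs (l.map s).prod ((-1) ^ l.length) t := by
  induction l with
  | nil => exact ⟨0, fun k x n => by simp⟩
  | cons i l ih =>
    obtain ⟨t, ht⟩ := ih
    rcases i.eq_zero_or_eq_succ with rfl | ⟨j, rfl⟩
    · refine ⟨1 - t, fun k x n => ?_⟩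
      rw [List.map_cons, List.prod_cons, LinearEquiv.mul_apply, ht, s_zero_pt, pt_inj,
        List.length_cons, pow_succ]
      push_cast
      exact ⟨rfl, by ring, by ring⟩
    · obtain rfl : j = 0 := Subsingleton.elim _ _
      refine ⟨-t, fun k x n => ?_⟩
      rw [List.map_cons, List.prod_cons, LinearEquiv.mul_apply, ht]
      change s 1 _ = _
      rw [s_one_pt, pt_inj, List.length_cons, pow_succ]
      push_cast
      exact ⟨rfl, by ring, by ring⟩

/-- `word_actsAs` computes the sign from any word; a shortest word identifies it with `ε v`. -/
theorem exists_actsAs {v : Weight ≃ₗ[ℂ] Weight} (hv : v ∈ W) : ∃ t, ActsAs v (ε v) t := by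
  obtain ⟨l, hl⟩ := exists_word hv
  have hne : {n | ∃ l : List (Fin 2), l.length = n ∧ (l.map s).prod = v}.Nonempty :=
    ⟨l.length, l, rfl, hl⟩
  obtain ⟨l', h1, h2⟩ := Nat.sInf_mem hne
  obtain ⟨t, ht⟩ := word_actsAs l'
  rw [h2, h1] at ht
  exact ⟨t, ht⟩

/-- On level 0 the displacement only affects the δ-coefficient, so the image of α shows the sign. -/
theorem ε_eq_of_apply {v : Weight ≃ₗ[ℂ] Weight} (hv : v ∈ W) {σ : ℤ} {n : ℂ}
    (h : v (pt 0 1 0) = pt 0 σ n) : ε v = σ := by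
  obtain ⟨t, ht⟩ := exists_actsAs hv
  rw [ht, pt_inj] at h
  have := h.2.1
  simpa using this

theorem ε_one : ε 1 = 1 := ε_eq_of_apply (n := 0) W.one_mem (by simp)

theorem ε_s (i : Fin 2) : ε (s i) = -1 := by
  rcases i.eq_zero_or_eq_succ with rfl | ⟨j, rfl⟩
  · exact ε_eq_of_apply (n := 1) (s_mem_W 0) (by rw [s_zero_pt, pt_inj]; simp)
  · obtain rfl : j = 0 := Subsingleton.elim _ _
    exact ε_eq_of_apply (n := 0) (s_mem_W 1) (by rw [s_one_pt, pt_inj]; simp)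

theorem ε_inv {v : Weight ≃ₗ[ℂ] Weight} (hv : v ∈ W) : ε v⁻¹ = ε v := by
  obtain ⟨t, ht⟩ := exists_actsAs hv
  obtain ⟨t', ht'⟩ := exists_actsAs (W.inv_mem hv)
  have h : v (v⁻¹ (pt 0 1 0)) = pt 0 1 0 := v.apply_symm_apply _
  rw [ht', ht, pt_inj] at h
  have h1 : ε v * ε v⁻¹ = 1 := by
    have := h.2.1
    simp only [mul_one, mul_zero, zero_mul, add_zero] at this
    exact_mod_cast this
  rcases neg_one_pow_eq_or ℤ (length v) with h2 | h2
  · rw [show ε v = 1 from h2] at h1 ⊢; omega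
  · rw [show ε v = -1 from h2] at h1 ⊢; omega

/-! ### The weights of `L(Λ)` in coordinates -/

/-- `aω₀ + bω₁ + jα + nδ` is a weight of `L(aω₀ + bω₁)`. -/
def IsWeightAt (a b : ℕ) (j n : ℤ) : Prop := pt (a + b / 2) (b / 2 + j) n ∈ P (wt a b)

theorem exists_isWeightAt {a b : ℕ} {μ : Weight} (hμ : μ ∈ P (wt a b)) :
    ∃ j n : ℤ, n ≤ 0 ∧ IsWeightAt a b j n ∧ μ = pt (a + b / 2) (b / 2 + j) n := by
  obtain ⟨l, hl⟩ := exists_rootSum_of_mem_P hμ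
  -- Only α₀ involves δ, so −n counts the letters 0 in the word.
  have key : ∃ j n : ℤ, n ≤ 0 ∧ rootSum l = pt 0 (-j) (-n) := by
    clear hl
    induction l with
    | nil => exact ⟨0, 0, le_rfl, by simp [pt]⟩
    | cons i l ih =>
      obtain ⟨j, n, hn, h⟩ := ih
      rcases i.eq_zero_or_eq_succ with rfl | ⟨i, rfl⟩
      · refine ⟨j + 2, n - 1, by omega, ?_⟩
        rw [rootSum_cons, h, ← one_smul ℂ (simpleRoot 0), smul_simpleRoot_zero, pt_add, pt_inj]
        push_cast
        exact ⟨by ring, by ring, by ring⟩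
      · obtain rfl : i = 0 := Subsingleton.elim _ _
        refine ⟨j - 1, n, hn, ?_⟩
        rw [rootSum_cons, h]
        change simpleRoot 1 + _ = _
        rw [← one_smul ℂ (simpleRoot 1), smul_simpleRoot_one, pt_add, pt_inj]
        push_cast
        exact ⟨by ring, by ring, by ring⟩
  obtain ⟨j, n, hn, h⟩ := key
  have h1 : μ = pt (a + b / 2) (b / 2 + j) n := by
    rw [hl, h, wt_eq, pt_sub, pt_inj]
    exact ⟨by ring, by ring, by ring⟩
  exact ⟨j, n, hn, by rw [IsWeightAt, ← h1]; exact hμ, h1⟩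

theorem wt_coroot (a b : ℕ) (i : Fin 2) : ∃ m : ℕ, wt a b (simpleCoroot i) = m := by
  rcases i.eq_zero_or_eq_succ with rfl | ⟨i, rfl⟩
  · exact ⟨a, by rw [wt_eq, pt_coroot_zero]; ring⟩
  · obtain rfl : i = 0 := Subsingleton.elim _ _
    refine ⟨b, ?_⟩
    change wt a b (simpleCoroot 1) = _
    rw [wt_eq, pt_coroot_one]; ring

/-- The weight string through `μ` in the direction of `α_i`. -/
theorem string_mem_P {a b : ℕ} {μ : Weight} (hμ : μ ∈ P (wt a b)) {i : Fin 2} {m t : ℤ}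
    (hm : μ (simpleCoroot i) = m) (ht : (0 ≤ t ∧ t ≤ m) ∨ (m ≤ t ∧ t ≤ 0)) :
    μ - (t : ℂ) • simpleRoot i ∈ P (wt a b) := by
  obtain ⟨k, hk⟩ := wt_coroot a b i
  rcases ht with ⟨h0, h1⟩ | ⟨h0, h1⟩
  · lift t to ℕ using h0
    lift m to ℕ using by omega
    exact sub_mem_P hμ hm (by omega)
  · obtain ⟨t', rfl⟩ : ∃ t', t = -t' := ⟨-t, by ring⟩
    obtain ⟨m', rfl⟩ : ∃ m', m = -m' := ⟨-m, by ring⟩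
    lift t' to ℕ using by omega
    lift m' to ℕ using by omega
    have := add_mem_P hμ hk (by rw [hm]; push_cast; rfl) (t := t') (by omega)
    convert this using 1
    push_cast; module

theorem isStringClosed {a b : ℕ} (hpos : 0 < 2 * (a : ℤ) + b) :
    IsStringClosed a b (IsWeightAt a b) where
  pos := hpos
  top := by
    have := highest_mem_P (wt a b)
    rw [IsWeightAt]
    convert this using 1
    rw [wt_eq]; simp
  le_zero {j n} h := by
    obtain ⟨j', n', hn', -, h1⟩ := exists_isWeightAt h
    rw [pt_inj] at h1
    rwa [Int.cast_injective h1.2.2]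
  string_one {j n i} h hi := by
    have := string_mem_P h (i := 1) (m := b + 2 * j) (t := j - i) (by
      rw [pt_coroot_one]; push_cast; ring) (by omega)
    rw [smul_simpleRoot_one, pt_sub] at this
    rw [IsWeightAt]
    convert this using 2 <;> (push_cast; ring)
  string_zero {j n r} h hr := by
    have := string_mem_P h (i := 0) (m := a - j) (t := r) (by
      rw [pt_coroot_zero]; push_cast; ring) (by omega)
    rw [smul_simpleRoot_zero, pt_sub] at this
    rw [IsWeightAt]
    convert this using 2 <;> (push_cast; ring)

/-- A simple reflection goes to the far end of a weight string. -/
theorem apply_mem_P {a b : ℕ} {v : Weight ≃ₗ[ℂ] Weight} (hv : v ∈ W) {μ : Weight}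
    (hμ : μ ∈ P (wt a b)) : v μ ∈ P (wt a b) := by
  obtain ⟨l, rfl⟩ := exists_word hv
  clear hv
  induction l with
  | nil => exact hμ
  | cons i l ih =>
    rw [List.map_cons, List.prod_cons, LinearEquiv.mul_apply, s_apply]
    obtain ⟨j, n, -, -, h⟩ := exists_isWeightAt ih
    obtain ⟨m, hm⟩ : ∃ m : ℤ, (l.map s).prod μ (simpleCoroot i) = m := by
      rw [h]
      rcases i.eq_zero_or_eq_succ with rfl | ⟨i, rfl⟩
      · exact ⟨a - j, by rw [pt_coroot_zero]; push_cast; ring⟩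
      · obtain rfl : i = 0 := Subsingleton.elim _ _
        refine ⟨b + 2 * j, ?_⟩
        change pt _ _ _ (simpleCoroot 1) = _
        rw [pt_coroot_one]; push_cast; ring
    rw [hm]
    exact string_mem_P ih hm (by omega)

theorem IsMaxAt.mem_Po {a b : ℕ} {j n : ℤ} (h : IsMaxAt (IsWeightAt a b) j n) :
    pt (a + b / 2) (b / 2 + j) n ∈ Po (wt a b) := by
  refine ⟨h.1, fun m hm hmem => ?_⟩
  rw [zsmul_δ_eq, pt_add, add_zero, add_zero, ← Int.cast_add] at hmem
  have := h.2 _ hmem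
  omega

/-! ### The main theorem -/

theorem exists_of_mem_Q {μ : Weight} (hμ : μ ∈ Q) : ∃ p q : ℤ, μ = pt 0 p q := by
  obtain ⟨p, q, rfl⟩ := AddSubgroup.mem_closure_pair.1 hμ
  exact ⟨p, q, by rw [zsmul_α_eq, zsmul_δ_eq, pt_add, pt_inj]; simp⟩

/-- Apply v⁻¹, which fixes δ and has the same sign as v: `t` is its displacement and `(j, n)` is the
position of v⁻¹μ. Doubling clears the level m₀'' + m₁''/2 + 3/2 of Λ'' + ρ. -/
theorem exists_coordinates_of_isVS {m₀ m₁ a b m₀'' m₁'' : ℕ} {μ : Weight}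
    {v : Weight ≃ₗ[ℂ] Weight} {S : ℤ} (hμ : μ ∈ P (wt a b))
    (h : IsVS (wt m₀ m₁) (wt m₀'' m₁'') μ v S) : ∃ t j n : ℤ, IsWeightAt a b j n ∧
      (m₁ : ℤ) + 1 = b + 2 * j + ε v * (m₁'' + 1) + 2 * ((2 * m₀'' + m₁'' + 3) * t) ∧
      2 * S = 2 * n - ε v * ((m₁'' + 1) * t) - (2 * m₀'' + m₁'' + 3) * t ^ 2 := by
  obtain ⟨hv, he⟩ := h
  obtain ⟨t, ht⟩ := exists_actsAs (W.inv_mem hv)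
  rw [ε_inv hv] at ht
  obtain ⟨j, n, -, hjn, hj⟩ := exists_isWeightAt (apply_mem_P (W.inv_mem hv) hμ)
  have h1 := congrArg (v⁻¹ : Weight ≃ₗ[ℂ] Weight) he
  rw [map_add, map_add, map_add, hj, show v⁻¹ (v (wt m₀ m₁ + ρ)) = wt m₀ m₁ + ρ from
    v.symm_apply_apply _, zsmul_δ_eq, wt_eq, wt_eq, ρ_eq, ht, ht, ht, pt_add, pt_add, pt_add,
    pt_add, pt_inj] at h1
  obtain ⟨-, h2, h3⟩ := h1
  refine ⟨t, j, n, hjn, ?_, ?_⟩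
  · have : (((m₁ : ℤ) + 1 : ℤ) : ℂ) =
        (b + 2 * j + ε v * (m₁'' + 1) + 2 * ((2 * m₀'' + m₁'' + 3) * t) : ℤ) := by
      push_cast
      linear_combination (-2) * h2
    exact_mod_cast this
  · have : ((2 * S : ℤ) : ℂ) =
        (2 * n - ε v * ((m₁'' + 1) * t) - (2 * m₀'' + m₁'' + 3) * t ^ 2 : ℤ) := by
      push_cast
      linear_combination (-2) * h3
    exact_mod_cast this

end A22

end

theorem mainTheorem11 (m₀ m₁ m₀' m₁' m₀'' m₁'' : ℕ) (Λ Λ' Λ'' : A22.Weight)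
    (hΛ : Λ = A22.wt m₀ m₁) (hΛ' : Λ' = A22.wt m₀' m₁') (hΛ'' : Λ'' = A22.wt m₀'' m₁'')
    (hc' : 0 < Λ' A22.c) (hc'' : 0 < Λ'' A22.c) (hQ : Λ - Λ' - Λ'' ∈ A22.Q) :
    A22.MaxOccursAt Λ Λ' Λ'' 1
      (Λ' + ((1 / 2 : ℂ) * ((m₁ : ℂ) - m₁' - m₁'')) • A22.α) ∧
    (A22.MaxOccursAt Λ Λ' Λ'' (-1)
        (Λ' - ((1 / 2 : ℂ) * ((m₁' : ℂ) + m₁'' + m₁) + 1) • A22.α) ∨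
      A22.MaxOccursAt Λ Λ' Λ'' (-1)
        (Λ' - ((1 / 2 : ℂ) * ((m₁' : ℂ) + m₁'' + m₁)
          - 2 * (Λ' A22.c + Λ'' A22.c + 1)) • A22.α)) := by
  open A22 in
  subst hΛ hΛ' hΛ''
  have hpos : 0 < 2 * (m₀' : ℤ) + m₁' := by
    by_contra h
    obtain ⟨rfl, rfl⟩ : m₀' = 0 ∧ m₁' = 0 := by omega
    rw [wt_eq, pt_c] at hc'
    simp at hc'
  have hE := isStringClosed hpos
  obtain ⟨p, q, hpq⟩ := exists_of_mem_Q hQ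
  simp only [wt_eq, pt_sub, pt_inj] at hpq
  obtain ⟨hk, hx, -⟩ := hpq
  have hJ : 2 * p + m₁' = (m₁ : ℤ) - m₁'' := by
    have : ((2 * p + m₁' : ℤ) : ℂ) = ((m₁ : ℤ) - m₁'' : ℤ) := by
      push_cast; linear_combination (-2) * hx
    exact_mod_cast this
  have hlev : 2 * (m₀ : ℤ) + m₁ = 2 * m₀' + m₁' + (2 * m₀'' + m₁'') := by
    have : ((2 * (m₀ : ℤ) + m₁ : ℤ) : ℂ) = (2 * m₀' + m₁' + (2 * m₀'' + m₁'') : ℤ) := by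
      push_cast; linear_combination 2 * hk
    exact_mod_cast this
  have hJC : (m₁ : ℂ) = 2 * p + m₁' + m₁'' := by linear_combination 2 * hx
  have hlevC : (m₀ : ℂ) = m₀' + m₀'' - p := by linear_combination hk - hx
  constructor
  · obtain ⟨N, hN⟩ := hE.exists_isMaxAt p
    -- The case t = 0, v = 1: here S is the largest n at position p.
    have hVS : IsVS (wt m₀ m₁) (wt m₀'' m₁'') (pt (m₀' + m₁' / 2) (m₁' / 2 + p) N) 1 N := by
      refine ⟨W.one_mem, ?_⟩
      rw [LinearEquiv.coe_one, id, wt_eq, wt_eq, ρ_eq, zsmul_δ_eq]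
      simp only [pt_add, pt_inj, hlevC, hJC]
      exact ⟨by ring, by ring, by ring⟩
    have hT : pt (m₀' + m₁' / 2) (m₁' / 2 + p) N ∈ T (wt m₀ m₁) (wt m₀' m₁') (wt m₀'' m₁'') :=
      ⟨hN.mem_Po, _, _, hVS⟩
    refine ⟨N, ⟨⟨_, hT, _, hVS, ε_one⟩, ?_⟩, _, hT, ⟨_, hVS, ε_one⟩, N, ?_⟩
    · rintro S ⟨μ, hμ, v, hv, hε⟩
      obtain ⟨t, j, n, hjn, h1, h2⟩ := exists_coordinates_of_isVS hμ.1.1 hv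
      rw [hε, one_mul] at h1 h2
      obtain rfl : j = p - (2 * m₀'' + m₁'' + 3) * t := by omega
      obtain ⟨n', hn', hle⟩ := hE.exists_even_bound (by positivity) (by positivity)
        (by positivity) (by positivity) hlev hJ hjn h2
      exact hle.trans (hN.2 _ hn')
    · rw [wt_eq, smul_α_eq, smul_δ_eq, pt_add, pt_add, pt_inj, hJC]
      exact ⟨by ring, by ring, by ring⟩
  -- For sign −1 the position of v⁻¹μ is `Z` when t = 0 and Z − (2m₀'' + m₁'' + 3) when t = 1.
  · set Z : ℤ := p + m₁'' + 1 with hZdef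
    have hZ : 2 * Z + m₁' = (m₁ : ℤ) + m₁'' + 2 := by omega
    obtain ⟨N₀, hN₀⟩ := hE.exists_isMaxAt Z
    obtain ⟨N₁, hN₁⟩ := hE.exists_isMaxAt (Z - (2 * m₀'' + m₁'' + 3))
    have bound : ∀ S ∈ SSet (wt m₀ m₁) (wt m₀' m₁') (wt m₀'' m₁'') (-1),
        S ≤ N₀ ∨ S ≤ N₁ - m₀'' - 1 := by
      rintro S ⟨μ, hμ, v, hv, hε⟩
      obtain ⟨t, j, n, hjn, h1, h2⟩ := exists_coordinates_of_isVS hμ.1.1 hv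
      rw [hε] at h1 h2
      obtain rfl : j = Z - (2 * m₀'' + m₁'' + 3) * t := by omega
      rcases hE.exists_odd_bound (by positivity) (by positivity)
        (by positivity) (by positivity) hlev hZ hjn (by rw [h2]; ring) with
        ⟨n', hn', hle⟩ | ⟨n', hn', hle⟩
      · exact Or.inl (hle.trans (hN₀.2 _ hn'))
      · have := hN₁.2 _ hn'
        exact Or.inr (by omega)
    -- The larger of the two bounds decides which of the two weights attains the maximum.
    rcases le_total (N₁ - m₀'' - 1) N₀ with hle | hle
    · left
      -- Here v = s₁, so λ is the mirror image under s₁ of the highest weight at `Z`; reflection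
      -- preserves δ-maximality.
      have hmax := hE.isMaxAt_reflect_one hN₀
      have hVS : IsVS (wt m₀ m₁) (wt m₀'' m₁'')
          (pt (m₀' + m₁' / 2) (m₁' / 2 + (-m₁' - Z : ℤ)) N₀) (s 1) N₀ := by
        refine ⟨s_mem_W 1, ?_⟩
        rw [wt_eq, wt_eq, ρ_eq, zsmul_δ_eq]
        simp only [pt_add, s_one_pt, pt_inj, hlevC, hJC, hZdef]
        push_cast
        exact ⟨by ring, by ring, by ring⟩
      have hT : pt (m₀' + m₁' / 2) (m₁' / 2 + (-m₁' - Z : ℤ)) N₀ ∈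
          T (wt m₀ m₁) (wt m₀' m₁') (wt m₀'' m₁'') := ⟨hmax.mem_Po, _, _, hVS⟩
      refine ⟨N₀, ⟨⟨_, hT, _, hVS, ε_s 1⟩, fun S hS => ?_⟩, _, hT, ⟨_, hVS, ε_s 1⟩, N₀, ?_⟩
      · rcases bound S hS with h | h <;> omega
      · rw [wt_eq, smul_α_eq, smul_δ_eq, pt_sub, pt_add, pt_inj, hJC, hZdef]
        push_cast
        exact ⟨by ring, by ring, by ring⟩
    · right
      -- Here v = s₀, whose displacement is 1, and λ is the mirror image under s₀ of the highest
      -- weight at the t = 1 position.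
      have hmax := hE.isMaxAt_reflect_zero hN₁
      set j : ℤ := 2 * m₀' - (Z - (2 * m₀'' + m₁'' + 3)) with hj
      set n : ℤ := N₁ - (m₀' - (Z - (2 * m₀'' + m₁'' + 3))) with hn
      have hVS : IsVS (wt m₀ m₁) (wt m₀'' m₁'')
          (pt (m₀' + m₁' / 2) (m₁' / 2 + j) n) (s 0) (N₁ - m₀'' - 1) := by
        refine ⟨s_mem_W 0, ?_⟩
        rw [wt_eq, wt_eq, ρ_eq, zsmul_δ_eq]
        simp only [pt_add, s_zero_pt, pt_inj, hlevC, hJC, hj, hn, hZdef]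
        push_cast
        exact ⟨by ring, by ring, by ring⟩
      have hT : pt (m₀' + m₁' / 2) (m₁' / 2 + j) n ∈
          T (wt m₀ m₁) (wt m₀' m₁') (wt m₀'' m₁'') := ⟨hmax.mem_Po, _, _, hVS⟩
      refine ⟨_, ⟨⟨_, hT, _, hVS, ε_s 0⟩, fun S hS => ?_⟩, _, hT, ⟨_, hVS, ε_s 0⟩, n, ?_⟩
      · rcases bound S hS with h | h <;> omega
      · rw [wt_eq, wt_eq, pt_c, pt_c, smul_α_eq, smul_δ_eq, pt_sub, pt_add, pt_inj, hJC, hj, hZdef]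
        push_cast
        exact ⟨by ring, by ring, by ring⟩
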